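/- **Setting.** All logarithms are to base $2$. Let $q\ge 2$ and let $U$ be a $q$-ary discrete memoryless channel (DMC), i.e. a row-stochastic matrix $(U(y|x))_{x,y\in[1:q]}$. For $n\ge 1$, the noisy permutation channel $\Sigma_{n,U}$ has input and output alphabet $[1:q]^n$: the components of the transmitted vector are first permuted by a uniformly random permutation of $\{1,\dots,n\}$, and each component of the result is then passed independently through $U$. An identification (ID) code with $L$ messages and stochastic decoders for a channel $P(y|x)$ with input alphabet $\mathcal A$ and output alphabet $\mathcal B$ is a family $(Q_i,P_i)_{1\le i\le L}$, where $Q_i$ is a probability distribution on $\mathcal A$ (message $i$ is encoded as $x$ with probability $Q_i(x)$) and $P_i(\cdot|y)$ is, for each $y\in\mathcal B$, a probability distribution on $\{0,1\}$ (decoder $i$ accepts with probability $P_i(1|y)$). It has deterministic decoders if $P_i(1|y)=\mathbf 1\{y\in\mathcal D_i\}$ for some $\mathcal D_i\subseteq\mathcal B$. Its Type-I and Type-II error probabilities are $$\lambda_1=\max_{1\le i\le L}\sum_{x,y}Q_i(x)P(y|x)P_i(0|y),\qquad \lambda_2=\max_{1\le i\ne j\le L}\sum_{x,y}Q_i(x)P(y|x)P_j(1|y),$$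 a maximum over the empty set being $0$. **Theorem (Identification under stochastic encoding).** Let $q\ge2$ and let $U$ be a $q$-ary DMC. (i) *Achievability.* Let $r$ be the rank of the matrix $U$. For every real sequence $\epsilon_n\to0$ there is a sequence of ID codes with deterministic decoders for $\Sigma_{n,U}$, the $n$-th one with $\left\lfloor 2^{\epsilon_n (n/\log n)^{(r-1)/2}}\right\rfloor$ messages, whose error probabilities satisfy $\lambda_{1,n}\to0$ and $\lambda_{2,n}\to 0$ as $n\to\infty$. (The message size is meant for $n\ge 2$.) (ii) *Strong converse.* Suppose that all entries of $U$ are strictly positive. Let $(n_i)$ be a sequence of natural numbers and $(c_i)$ a sequence of real numbers with $n_i\to\infty$ and $c_i\to\infty$. For any sequence of ID codes with stochastic decoders, the $i$-th one for $\Sigma_{n_i,U}$ with at least $$\left\lfloor 2^{\,c_i\, n_i^{(q-1)/2}(\log n_i)^{1+(q-1)(q-2)/2}}\right\rfloor$$ messages and with error probabilities $\lambda_{1,i},\lambda_{2,i}$, one has $\liminf_{i\to\infty}(\lambda_{1,i}+\lambda_{2,i})\ge1$. -/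

import Mathlib

open Filter Topology

namespace IdCoding

/-- A channel with input alphabet `A` and finite output alphabet `B`: `P.prob x y` is the
conditional probability `P(y|x)`. -/
structure Channel (A B : Type*) [Fintype B] where
  prob : A → B → ℝ
  nonneg : ∀ x y, 0 ≤ prob x y
  sum_eq_one : ∀ x, ∑ y, prob x y = 1

namespace Channel

/-- The transition probability matrix of a channel: rows are inputs, columns are outputs. -/
def matrix {A B : Type*} [Fintype B] (P : Channel A B) : Matrix A B ℝ :=
  Matrix.of P.prob

/-- The cascade of two channels: first `P`, then `R`. -/
def comp {A B D : Type*} [Fintype B] [Fintype D] (P : Channel A B) (R : Channel B D) :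
    Channel A D where
  prob x y := ∑ z, P.prob x z * R.prob z y
  nonneg x y := Finset.sum_nonneg fun z _ => mul_nonneg (P.nonneg x z) (R.nonneg z y)
  sum_eq_one x := by
    rw [Finset.sum_comm]
    simp [← Finset.mul_sum, R.sum_eq_one, P.sum_eq_one]

/-- The `n`-fold memoryless extension `U^(n)` of a channel `U`. -/
def memoryless {A B : Type*} [Fintype B] (U : Channel A B) (n : ℕ) :
    Channel (Fin n → A) (Fin n → B) where
  prob x y := ∏ i, U.prob (x i) (y i)
  nonneg x y := Finset.prod_nonneg fun i _ => U.nonneg (x i) (y i)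
  sum_eq_one x := by
    classical
    rw [← Fintype.prod_sum (fun i b => U.prob (x i) b)]
    simp [U.sum_eq_one]

/-- The `n`-block uniform permutation channel over the alphabet `A`: the output is
`z i = x (σ⁻¹ i)` for a uniformly random permutation `σ` of the `n` positions. -/
noncomputable def permutation (A : Type*) [Fintype A] [DecidableEq A] (n : ℕ) :
    Channel (Fin n → A) (Fin n → A) where
  prob x z := (1 / (n.factorial : ℝ)) *
    ∑ σ : Equiv.Perm (Fin n), if ∀ i, z i = x (σ⁻¹ i) then 1 else 0
  nonneg x z := by
    refine mul_nonneg (by positivity) (Finset.sum_nonneg fun σ _ => ?_)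
    split_ifs <;> norm_num
  sum_eq_one x := by
    rw [← Finset.mul_sum, Finset.sum_comm]
    have h : ∀ σ : Equiv.Perm (Fin n),
        (∑ z : Fin n → A, if ∀ i, z i = x (σ⁻¹ i) then (1 : ℝ) else 0) = 1 := by
      intro σ
      have : ∀ z : Fin n → A, (∀ i, z i = x (σ⁻¹ i)) ↔ z = fun i => x (σ⁻¹ i) :=
        fun z => ⟨fun h => funext h, fun h i => congrFun h i⟩
      simp only [this]
      simp
    simp only [h, Finset.sum_const, Finset.card_univ, Fintype.card_perm, Fintype.card_fin,
      nsmul_eq_mul, mul_one]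
    exact one_div_mul_cancel (by positivity)

/-- The `n`-block noisy permutation channel `Σ_{n,U}`: a uniformly random permutation of the
components followed by the memoryless channel `U`. -/
noncomputable def noisyPermutation {A : Type*} [Fintype A] [DecidableEq A] (U : Channel A A)
    (n : ℕ) : Channel (Fin n → A) (Fin n → A) :=
  (permutation A n).comp (U.memoryless n)

end Channel

/-- An identification code with `L` messages, stochastic encoders and stochastic decoders:
`enc i` is the distribution of the channel input for message `i`, and
`(dec i).prob y true` is the probability that decoder `i` accepts the channel output `y`. -/
structure IDCode (A B : Type*) [Fintype A] [Fintype B] (L : ℕ) where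
  enc : Fin L → stdSimplex ℝ A
  dec : Fin L → Channel B Bool

/-- An identification code with `L` messages, stochastic encoders and deterministic decoders:
decoder `i` accepts the channel output `y` if and only if `y ∈ acc i`. -/
structure DetDecIDCode (A B : Type*) [Fintype A] [Fintype B] (L : ℕ) where
  enc : Fin L → stdSimplex ℝ A
  acc : Fin L → Finset B

/-- The deterministic decision rule with acceptance region `D`, as a stochastic one. -/
def decisionRule {B : Type*} [DecidableEq B] (D : Finset B) : Channel B Bool where
  prob y b := if b = decide (y ∈ D) then 1 else 0
  nonneg y b := by split_ifs <;> norm_num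
  sum_eq_one y := by simp

/-- A code with deterministic decoders, as a code with stochastic decoders. -/
def DetDecIDCode.toIDCode {A B : Type*} [Fintype A] [Fintype B] [DecidableEq B] {L : ℕ}
    (C : DetDecIDCode A B L) : IDCode A B L where
  enc := C.enc
  dec i := decisionRule (C.acc i)

namespace IDCode

variable {A B : Type*} [Fintype A] [Fintype B] {L : ℕ}

/-- The probability that decoder `j` accepts when message `i` is encoded and sent over `P`. -/
def acceptProb (C : IDCode A B L) (P : Channel A B) (i j : Fin L) : ℝ :=
  ∑ x, ∑ y, (C.enc i : A → ℝ) x * P.prob x y * (C.dec j).prob y true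

/-- The probability that decoder `i` rejects when message `i` is encoded and sent over `P`. -/
def missProb (C : IDCode A B L) (P : Channel A B) (i : Fin L) : ℝ :=
  ∑ x, ∑ y, (C.enc i : A → ℝ) x * P.prob x y * (C.dec i).prob y false

/-- The Type-I error probability: the largest missed detection probability
(`0` if there is no message). -/
noncomputable def typeI (C : IDCode A B L) (P : Channel A B) : ℝ :=
  ⨆ i : Fin L, C.missProb P i

/-- The Type-II error probability: the largest probability that a wrong message is accepted
(`0` if there are fewer than two messages). -/
noncomputable def typeII (C : IDCode A B L) (P : Channel A B) : ℝ :=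
  ⨆ p : {p : Fin L × Fin L // p.1 ≠ p.2}, C.acceptProb P p.1.1 p.1.2

end IDCode

end IdCoding

/-! The channel sees its input only through its type, the vector of symbol counts, so everything
turns on how many types are distinguishable at the output.

Strong converse. Changing one input symbol moves the output law by only O(1/√n) in L¹. The
likelihood ratio at the changed position is, after the random permutation, replaced by its average
over all positions carrying a frequent symbol `c`; these are at least n/q centred independent terms,
bounded because `U` is positive (`sum_abs_noisyPermutation_sub_update_le`). Hence types rounded to
multiples of η√n form O(n^((q-1)/2)) classes of nearly indistinguishable inputs. An encoder matters
only through its distribution on these N classes; rounding its weights to multiples of 1/M leaves at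
most (M+1)^N possibilities, so with more messages two of them nearly share a class distribution and
the errors sum to almost 1 (`le_typeI_add_typeII`). With M = n^q the count is 2^O(N log n), so a
single power of log n suffices; the larger exponent in the statement is slack.

Achievability. Fix r linearly independent rows of `U`. Input types on an (r-1)-dimensional grid of
spacing about √(n log n) have mean output types separated by a constant times that spacing, so
Chebyshev's inequality decodes them with error O(1/log n) (`exists_separated_inputs`,
`le_sum_noisyPermutation`). There are of order (n/log n)^((r-1)/2) grid points. They are labelled by
pairs (position, letter), with M positions; message i is a word and is sent as a uniformly random
point of its graph. A Gilbert–Varshamov argument gives 2^M words with few pairwise agreements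
(`exists_small_agreement`), and the fraction of agreements bounds the Type-II error up to the
decoding error. -/

namespace IdCoding

/-! ### Second moments under product measures -/

section Moments

variable {ι B : Type*} [Fintype ι] [DecidableEq ι] [Fintype B]

/-- Expectation of a product of functions of single coordinates under a product measure. -/
lemma sum_prod_mul_prod (p f : ι → B → ℝ) :
    ∑ y : ι → B, (∏ i, p i (y i)) * ∏ i, f i (y i) = ∏ i, ∑ b, p i b * f i b := by
  classical
  rw [Fintype.prod_sum]
  simp [Finset.prod_mul_distrib]

lemma sum_prod_mul_apply_mul_apply (p : ι → B → ℝ) (hp : ∀ i, ∑ b, p i b = 1)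
    (f : ι → B → ℝ) (hf : ∀ i, ∑ b, p i b * f i b = 0) (i j : ι) :
    ∑ y : ι → B, (∏ l, p l (y l)) * (f i (y i) * f j (y j)) =
      if i = j then ∑ b, p i b * f i b ^ 2 else 0 := by
  -- Padding with ones makes this a product over all coordinates, in the case `i = j` as well.
  have key : ∀ y : ι → B, f i (y i) * f j (y j) =
      ∏ l, ((if l = i then f l (y l) else 1) * (if l = j then f l (y l) else 1)) := by
    intro y
    rw [Finset.prod_mul_distrib, Finset.prod_ite_eq', Finset.prod_ite_eq']
    simp
  simp only [key]
  rw [sum_prod_mul_prod p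
    (fun l b => (if l = i then f l b else 1) * (if l = j then f l b else 1))]
  split_ifs with h
  · subst h
    rw [Finset.prod_eq_single i]
    · simp [sq]
    · intro l _ hl
      simp [hl, hp]
    · simp
  · apply Finset.prod_eq_zero (Finset.mem_univ i)
    simp [h, hf]

/-- The second moment of a sum of independent centred variables. -/
lemma sum_prod_mul_sum_sq (p : ι → B → ℝ) (hp : ∀ i, ∑ b, p i b = 1)
    (f : ι → B → ℝ) (hf : ∀ i, ∑ b, p i b * f i b = 0) :
    ∑ y : ι → B, (∏ l, p l (y l)) * (∑ i, f i (y i)) ^ 2 = ∑ i, ∑ b, p i b * f i b ^ 2 := by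
  have hsq : ∀ y : ι → B, (∑ i, f i (y i)) ^ 2 = ∑ i, ∑ j, f i (y i) * f j (y j) :=
    fun y => by rw [sq, Finset.sum_mul_sum]
  simp only [hsq, Finset.mul_sum]
  rw [Finset.sum_comm]
  refine Finset.sum_congr rfl fun i _ => ?_
  rw [Finset.sum_comm]
  simp only [sum_prod_mul_apply_mul_apply p hp f hf i]
  simp

end Moments

/-! ### The law of the noisy permutation channel -/

namespace Channel

lemma prob_le_one {A B : Type*} [Fintype B] (P : Channel A B) (x : A) (y : B) :
    P.prob x y ≤ 1 := by
  rw [← P.sum_eq_one x]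
  exact Finset.single_le_sum (fun z _ => P.nonneg x z) (Finset.mem_univ y)

section Noisy

variable {A : Type*} [Fintype A] (U : Channel A A) {n : ℕ}

lemma memoryless_prob (x y : Fin n → A) :
    (U.memoryless n).prob x y = ∏ i, U.prob (x i) (y i) := rfl

lemma memoryless_comp_perm (x y : Fin n → A) (σ : Equiv.Perm (Fin n)) :
    (U.memoryless n).prob (x ∘ σ) (y ∘ σ) = (U.memoryless n).prob x y := by
  simp only [memoryless_prob, Function.comp_apply]
  exact Equiv.prod_comp σ fun i => U.prob (x i) (y i)

lemma average_perm {n : ℕ} (c : ℝ) :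
    (1 / (n.factorial : ℝ)) * ∑ _σ : Equiv.Perm (Fin n), c = c := by
  have : (n.factorial : ℝ) ≠ 0 := by positivity
  simp only [Finset.sum_const, Finset.card_univ, Fintype.card_perm, Fintype.card_fin,
    nsmul_eq_mul]
  field_simp

lemma sum_comp_perm (F : (Fin n → A) → ℝ) (σ : Equiv.Perm (Fin n)) :
    ∑ y : Fin n → A, F (y ∘ σ) = ∑ y, F y :=
  Equiv.sum_comp (Equiv.arrowCongr σ.symm (Equiv.refl A)) F

variable [DecidableEq A]

/-- The memoryless law is invariant under permuting input and output together, so the random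
permutation can be moved from the input to the output. -/
lemma noisyPermutation_prob (x y : Fin n → A) :
    (U.noisyPermutation n).prob x y =
      (1 / (n.factorial : ℝ)) * ∑ σ : Equiv.Perm (Fin n), (U.memoryless n).prob x (y ∘ σ) := by
  have h : ∀ σ : Equiv.Perm (Fin n), ∀ z : Fin n → A,
      (∀ i, z i = x (σ⁻¹ i)) ↔ z = x ∘ ⇑σ⁻¹ :=
    fun σ z => ⟨fun h => funext h, fun h i => congrFun h i⟩
  change ∑ z, (1 / (n.factorial : ℝ) * ∑ σ : Equiv.Perm (Fin n), if ∀ i, z i = x (σ⁻¹ i)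
    then 1 else 0) * (U.memoryless n).prob z y = _
  simp only [h, mul_assoc, ← Finset.mul_sum, Finset.sum_mul]
  rw [Finset.sum_comm]
  congr 1
  refine Finset.sum_congr rfl fun σ _ => ?_
  simp only [ite_mul, one_mul, zero_mul, Finset.sum_ite_eq', Finset.mem_univ, if_true]
  rw [← memoryless_comp_perm U _ _ σ]
  congr 1
  ext i
  simp

/-- The noisy permutation channel does not see the order of the input symbols. -/
lemma noisyPermutation_comp_perm (x y : Fin n → A) (τ : Equiv.Perm (Fin n)) :
    (U.noisyPermutation n).prob (x ∘ τ) y = (U.noisyPermutation n).prob x y := by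
  simp only [noisyPermutation_prob]
  congr 1
  rw [← Equiv.sum_comp (Equiv.mulRight τ)]
  refine Finset.sum_congr rfl fun σ _ => ?_
  rw [← memoryless_comp_perm U x _ τ]
  rfl

/-- Symmetric functions have the same expectation with or without the permutation. -/
lemma sum_noisyPermutation_mul (x : Fin n → A) (F : (Fin n → A) → ℝ)
    (hF : ∀ (σ : Equiv.Perm (Fin n)) y, F (y ∘ σ) = F y) :
    ∑ y, (U.noisyPermutation n).prob x y * F y = ∑ y, (U.memoryless n).prob x y * F y := by
  simp only [noisyPermutation_prob, mul_assoc, ← Finset.mul_sum, Finset.sum_mul]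
  rw [Finset.sum_comm]
  have : ∀ σ : Equiv.Perm (Fin n), ∑ y, (U.memoryless n).prob x (y ∘ σ) * F y =
      ∑ y, (U.memoryless n).prob x y * F y := by
    intro σ
    rw [← sum_comp_perm (fun y => (U.memoryless n).prob x y * F y) σ]
    simp only [hF]
  simp only [this]
  exact average_perm _

end Noisy

end Channel

/-! ### Effect of changing one input symbol -/

namespace Channel

variable {A : Type*} [Fintype A] (U : Channel A A) {n : ℕ}

lemma memoryless_eq_mul_update (hU : ∀ a b, 0 < U.prob a b) (x y : Fin n → A) (j : Fin n) (c : A) :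
    (U.memoryless n).prob x y = (U.memoryless n).prob (Function.update x j c) y *
      (U.prob (x j) (y j) / U.prob c (y j)) := by
  have h := (hU c (y j)).ne'
  simp only [memoryless_prob]
  rw [← Finset.mul_prod_erase _ _ (Finset.mem_univ j),
    ← Finset.mul_prod_erase Finset.univ (fun i => U.prob (Function.update x j c i) (y i))
      (Finset.mem_univ j)]
  rw [Finset.prod_congr rfl (g := fun i => U.prob (Function.update x j c i) (y i))
    (fun i hi => by rw [Function.update_of_ne (Finset.ne_of_mem_erase hi)])]
  simp only [Function.update_self]
  field_simp

/-- Likelihood ratios minus one are centred, as `sum_prod_mul_sum_sq` requires. -/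
lemma sum_mul_ratio_sub_one (hU : ∀ a b, 0 < U.prob a b) (a c : A) :
    ∑ b, U.prob c b * (U.prob a b / U.prob c b - 1) = 0 := by
  have : ∀ b, U.prob c b * (U.prob a b / U.prob c b - 1) = U.prob a b - U.prob c b := fun b => by
    have := (hU c b).ne'
    field_simp
  simp [this, U.sum_eq_one]

/-- If `x` has the symbol `c` at `j`, then a perturbation of the channel law at `j` may be
averaged over all positions with symbol `c`. -/
lemma sum_perm_memoryless_mul (x y : Fin n → A) (j i : Fin n) (hi : x i = x j) (g : A → ℝ) :
    ∑ σ : Equiv.Perm (Fin n), (U.memoryless n).prob x (y ∘ σ) * g (y (σ j)) =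
      ∑ σ : Equiv.Perm (Fin n), (U.memoryless n).prob x (y ∘ σ) * g (y (σ i)) := by
  rw [← Equiv.sum_comp (Equiv.mulRight (Equiv.swap i j))]
  refine Finset.sum_congr rfl fun σ _ => ?_
  have hx : x ∘ Equiv.swap i j = x := by
    ext l
    rcases eq_or_ne l i with rfl | hl
    · simp [hi]
    rcases eq_or_ne l j with rfl | hl'
    · simp [hi]
    · simp [Equiv.swap_apply_of_ne_of_ne hl hl']
  have : (U.memoryless n).prob x (y ∘ ⇑(σ * Equiv.swap i j)) =
      (U.memoryless n).prob x (y ∘ σ) := by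
    conv_lhs => rw [← hx]
    exact memoryless_comp_perm U x (y ∘ σ) (Equiv.swap i j)
  rw [Equiv.coe_mulRight, this]
  simp

variable [DecidableEq A]

/-- By symmetry, the likelihood ratio at `j` contributes as much as the one at any other position
where the modified word carries `c`. Passing to the average over these positions is what produces
cancellation. -/
lemma noisyPermutation_sub_update (hU : ∀ a b, 0 < U.prob a b) (x y : Fin n → A) (j : Fin n)
    (c : A) (I : Finset (Fin n)) (hI : ∀ i, i ∈ I ↔ Function.update x j c i = c) :
    (U.noisyPermutation n).prob x y -
        (U.noisyPermutation n).prob (Function.update x j c) y =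
      (1 / (n.factorial : ℝ)) * ∑ σ : Equiv.Perm (Fin n),
        (U.memoryless n).prob (Function.update x j c) (y ∘ σ) *
          ((1 / (I.card : ℝ)) * ∑ i ∈ I, (U.prob (x j) (y (σ i)) / U.prob c (y (σ i)) - 1)) := by
  have hj : j ∈ I := (hI j).2 (by simp)
  have hI0 : (I.card : ℝ) ≠ 0 := by
    exact_mod_cast (Finset.card_pos.2 ⟨j, hj⟩).ne'
  set g : A → ℝ := fun b => U.prob (x j) b / U.prob c b - 1 with hg
  set x' := Function.update x j c with hx'
  have h1 : ∀ i ∈ I, ∑ σ : Equiv.Perm (Fin n), (U.memoryless n).prob x' (y ∘ σ) * g (y (σ i)) =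
      ∑ σ : Equiv.Perm (Fin n), (U.memoryless n).prob x' (y ∘ σ) * g (y (σ j)) := by
    intro i hi
    refine (sum_perm_memoryless_mul U x' y j i ?_ g).symm
    rw [(hI i).1 hi, (hI j).1 hj]
  have h2 : ∑ σ : Equiv.Perm (Fin n), (U.memoryless n).prob x' (y ∘ σ) *
      ((1 / (I.card : ℝ)) * ∑ i ∈ I, g (y (σ i))) =
      ∑ σ : Equiv.Perm (Fin n), (U.memoryless n).prob x' (y ∘ σ) * g (y (σ j)) := by
    simp only [Finset.mul_sum]
    rw [Finset.sum_comm]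
    simp only [mul_left_comm _ (1 / (I.card : ℝ)), ← Finset.mul_sum]
    rw [Finset.sum_congr rfl h1]
    simp only [Finset.sum_const, nsmul_eq_mul]
    field_simp
  rw [h2, noisyPermutation_prob, noisyPermutation_prob, ← mul_sub, ← Finset.sum_sub_distrib]
  congr 1
  refine Finset.sum_congr rfl fun σ _ => ?_
  rw [memoryless_eq_mul_update U hU x (y ∘ σ) j c]
  simp only [hg, Function.comp_apply]
  ring

/-- Changing one input symbol into `c` changes the output law by the inverse of the square root
of the number of occurrences of `c`. -/
lemma sum_abs_noisyPermutation_sub_update_le (hU : ∀ a b, 0 < U.prob a b) {G : ℝ}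
    (hG : ∀ a c b, (U.prob a b / U.prob c b - 1) ^ 2 ≤ G) (x : Fin n → A) (j : Fin n) (c : A)
    (I : Finset (Fin n)) (hI : ∀ i, i ∈ I ↔ Function.update x j c i = c) :
    ∑ y, |(U.noisyPermutation n).prob x y -
        (U.noisyPermutation n).prob (Function.update x j c) y| ≤
      (G + 1) / √I.card := by
  have hj : j ∈ I := (hI j).2 (by simp)
  have hIpos : (0 : ℝ) < I.card := by
    exact_mod_cast (Finset.card_pos.2 ⟨j, hj⟩)
  set g : A → ℝ := fun b => U.prob (x j) b / U.prob c b - 1 with hg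
  set x' := Function.update x j c with hx'
  set h : (Fin n → A) → ℝ := fun y => (1 / (I.card : ℝ)) * ∑ i ∈ I, g (y i) with hh
  have step1 : ∑ y, |(U.noisyPermutation n).prob x y - (U.noisyPermutation n).prob x' y| ≤
      ∑ y, (U.memoryless n).prob x' y * |h y| := by
    calc ∑ y, |(U.noisyPermutation n).prob x y - (U.noisyPermutation n).prob x' y|
        ≤ ∑ y : Fin n → A, (1 / (n.factorial : ℝ)) * ∑ σ : Equiv.Perm (Fin n),
          (U.memoryless n).prob x' (y ∘ σ) * |h (y ∘ σ)| := by
          refine Finset.sum_le_sum fun y _ => ?_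
          rw [noisyPermutation_sub_update U hU x y j c I hI, abs_mul, abs_of_nonneg (by positivity)]
          refine mul_le_mul_of_nonneg_left ?_ (by positivity)
          refine (Finset.abs_sum_le_sum_abs _ _).trans (le_of_eq ?_)
          refine Finset.sum_congr rfl fun σ _ => ?_
          rw [abs_mul, abs_of_nonneg ((U.memoryless n).nonneg _ _)]
          rfl
      _ = ∑ y, (U.memoryless n).prob x' y * |h y| := by
          rw [← Finset.mul_sum, Finset.sum_comm]
          simp only [sum_comp_perm (fun y => (U.memoryless n).prob x' y * |h y|)]
          exact average_perm _
  have step2 : ∑ y, (U.memoryless n).prob x' y * h y ^ 2 ≤ G / I.card := by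
    have hs : ∀ y : Fin n → A, h y = (1 / (I.card : ℝ)) * ∑ i, if i ∈ I then g (y i) else 0 := by
      intro y
      simp [hh]
    have hm := sum_prod_mul_sum_sq (fun i => U.prob (x' i)) (fun i => U.sum_eq_one _)
      (fun i b => if i ∈ I then g b else 0) (fun i => by
        by_cases hi : i ∈ I
        · simp only [hi, if_true, (hI i).1 hi]
          exact sum_mul_ratio_sub_one U hU _ _
        · simp [hi])
    simp only [hs, mul_pow, mul_left_comm _ ((1 / (I.card : ℝ)) ^ 2), ← Finset.mul_sum,
      memoryless_prob]
    rw [hm]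
    have : ∀ i ∈ Finset.univ, ∑ b, U.prob (x' i) b * (if i ∈ I then g b else 0) ^ 2 ≤
        if i ∈ I then G else 0 := by
      intro i _
      by_cases hi : i ∈ I
      · simp only [hi, if_true]
        calc ∑ b, U.prob (x' i) b * g b ^ 2 ≤ ∑ b, U.prob (x' i) b * G :=
              Finset.sum_le_sum fun b _ => mul_le_mul_of_nonneg_left (hG _ _ _) (U.nonneg _ _)
          _ = G := by rw [← Finset.sum_mul, U.sum_eq_one, one_mul]
      · simp [hi]
    refine (mul_le_mul_of_nonneg_left (Finset.sum_le_sum this) (by positivity)).trans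
      (le_of_eq ?_)
    simp only [Finset.sum_ite_mem, Finset.univ_inter, Finset.sum_const, nsmul_eq_mul]
    field_simp
  set t := √(I.card : ℝ) with ht
  have htpos : 0 < t := Real.sqrt_pos.2 hIpos
  have htsq : (I.card : ℝ) = t ^ 2 := (Real.sq_sqrt hIpos.le).symm
  clear_value t
  -- A weighted arithmetic-geometric bound in place of Cauchy–Schwarz; with `t = √|I|` both
  -- resulting terms are of order `1 / t`.
  have step3 : ∀ y, |h y| ≤ t * h y ^ 2 + 1 / t := by
    intro y
    rw [← sq_abs (h y)]
    have h0 := abs_nonneg (h y)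
    have h1 : t * |h y| ^ 2 + 1 / t - |h y| = ((t * |h y| - 1 / 2) ^ 2 + 3 / 4) / t := by
      field_simp
      ring
    have h2 : 0 ≤ ((t * |h y| - 1 / 2) ^ 2 + 3 / 4) / t := by positivity
    linarith
  calc _ ≤ ∑ y, (U.memoryless n).prob x' y * |h y| := step1
    _ ≤ ∑ y, (U.memoryless n).prob x' y * (t * h y ^ 2 + 1 / t) :=
        Finset.sum_le_sum fun y _ => mul_le_mul_of_nonneg_left (step3 y) ((U.memoryless n).nonneg _ _)
    _ = t * ∑ y, (U.memoryless n).prob x' y * h y ^ 2 + 1 / t := by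
        simp only [mul_add, Finset.sum_add_distrib, ← Finset.sum_mul, (U.memoryless n).sum_eq_one,
          Finset.mul_sum, one_mul]
        congr 1
        exact Finset.sum_congr rfl fun y _ => by ring
    _ ≤ t * (G / I.card) + 1 / t := by gcongr
    _ = (G + 1) / t := by
        rw [htsq]
        field_simp

/-- Changing one input symbol changes the output law by `O(1/√n)`. -/
lemma sum_abs_noisyPermutation_sub_update_le_sqrt (hU : ∀ a b, 0 < U.prob a b) {G : ℝ}
    (hG : ∀ a c b, (U.prob a b / U.prob c b - 1) ^ 2 ≤ G) (x : Fin n → A) (j : Fin n) (b : A) :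
    ∑ y, |(U.noisyPermutation n).prob x y -
        (U.noisyPermutation n).prob (Function.update x j b) y| ≤
      2 * (G + 1) * √(Fintype.card A) / √n := by
  have : Nonempty A := ⟨b⟩
  have hn : 0 < n := j.pos
  have hG0 : 0 ≤ G := (sq_nonneg _).trans (hG b b b)
  -- Pigeonhole: some symbol is frequent. Both words are compared with the one having this `c` at
  -- `j`, whence the factor 2.
  obtain ⟨c, hc⟩ : ∃ c : A, (n : ℝ) ≤ Fintype.card A * (Finset.univ.filter (x · = c)).card := by
    by_contra! hlt
    have hsum : ∑ c : A, ((Finset.univ.filter (x · = c)).card : ℝ) = n := by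
      exact_mod_cast (Finset.card_eq_sum_card_fiberwise (s := Finset.univ) (t := Finset.univ)
        (f := x) (fun _ _ => Finset.mem_coe.2 (Finset.mem_univ _))).symm.trans (by simp)
    have := Finset.sum_lt_sum_of_nonempty (s := (Finset.univ : Finset A)) Finset.univ_nonempty
      fun c _ => hlt c
    rw [← Finset.mul_sum, hsum] at this
    simp at this
  set I := Finset.univ.filter (Function.update x j c · = c) with hIdef
  have hI : ∀ i, i ∈ I ↔ Function.update x j c i = c := by simp [hIdef]
  have hsub : Finset.univ.filter (x · = c) ⊆ I := by
    intro i hi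
    rw [hI]
    rw [Finset.mem_filter] at hi
    by_cases hij : i = j
    · simp [hij]
    · simp [hij, hi.2]
  have hcard : (n : ℝ) ≤ Fintype.card A * I.card :=
    hc.trans (mul_le_mul_of_nonneg_left (by exact_mod_cast Finset.card_le_card hsub) (by positivity))
  have hbound : (G + 1) / √I.card ≤ (G + 1) * √(Fintype.card A) / √n := by
    have hIpos : (0 : ℝ) < I.card := by
      exact_mod_cast (Finset.card_pos.2 ⟨j, (hI j).2 (by simp)⟩)
    rw [div_le_div_iff₀ (by positivity) (by positivity), mul_assoc, ← Real.sqrt_mul (by positivity)]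
    exact mul_le_mul_of_nonneg_left (Real.sqrt_le_sqrt hcard) (by positivity)
  have h1 := (sum_abs_noisyPermutation_sub_update_le U hU hG x j c I hI).trans hbound
  have h2 := (sum_abs_noisyPermutation_sub_update_le U hU hG (Function.update x j b) j c I
    (by simpa using hI)).trans hbound
  rw [Function.update_idem] at h2
  calc _ ≤ ∑ y, (|(U.noisyPermutation n).prob x y -
        (U.noisyPermutation n).prob (Function.update x j c) y| +
        |(U.noisyPermutation n).prob (Function.update x j b) y -
        (U.noisyPermutation n).prob (Function.update x j c) y|) := by
        refine Finset.sum_le_sum fun y _ => ?_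
        rw [abs_sub_comm ((U.noisyPermutation n).prob (Function.update x j b) y)]
        exact abs_sub_le _ _ _
    _ ≤ _ := by
        rw [Finset.sum_add_distrib]
        refine (add_le_add h1 h2).trans (le_of_eq ?_)
        ring

end Channel

/-! ### Types, and the Lipschitz bound in the type -/

/-- The number of occurrences of a symbol in a word. -/
def occ {A : Type*} [DecidableEq A] {n : ℕ} (x : Fin n → A) (a : A) : ℕ :=
  (Finset.univ.filter (x · = a)).card

section Occ

variable {A : Type*} [DecidableEq A] {n : ℕ}

lemma sum_occ [Fintype A] (x : Fin n → A) : ∑ a, occ x a = n := by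
  simpa [occ] using (Finset.card_eq_sum_card_fiberwise (s := Finset.univ) (t := Finset.univ)
        (f := x) (fun _ _ => Finset.mem_coe.2 (Finset.mem_univ _))).symm

lemma occ_le (x : Fin n → A) (a : A) : occ x a ≤ n :=
  (Finset.card_le_univ _).trans (by simp)

lemma occ_comp_perm (x : Fin n → A) (σ : Equiv.Perm (Fin n)) (a : A) :
    occ (x ∘ σ) a = occ x a := by
  simp only [occ, Finset.card_filter, Function.comp_apply]
  exact Equiv.sum_comp σ fun i => if x i = a then 1 else 0

lemma occ_update (x : Fin n → A) (j : Fin n) (b a : A) :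
    occ (Function.update x j b) a + (if x j = a then 1 else 0) =
      occ x a + (if b = a then 1 else 0) := by
  simp only [occ, Finset.card_filter]
  rw [← Finset.add_sum_erase _ _ (Finset.mem_univ j),
    ← Finset.add_sum_erase Finset.univ (fun i => if x i = a then 1 else 0) (Finset.mem_univ j)]
  rw [Finset.sum_congr rfl (g := fun i => if x i = a then 1 else 0)
    (fun i hi => by rw [Function.update_of_ne (Finset.ne_of_mem_erase hi)])]
  simp only [Function.update_self]
  ring

/-- Words of the same type are permutations of each other. -/
lemma exists_perm_of_occ_eq (x x' : Fin n → A) (h : ∀ a, occ x a = occ x' a) :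
    ∃ σ : Equiv.Perm (Fin n), x' = x ∘ σ := by
  have e : ∀ a, {i // x' i = a} ≃ {i // x i = a} := fun a =>
    Fintype.equivOfCardEq (by
      rw [Fintype.card_subtype, Fintype.card_subtype]
      exact (h a).symm)
  refine ⟨(Equiv.sigmaFiberEquiv x').symm.trans
    ((Equiv.sigmaCongrRight e).trans (Equiv.sigmaFiberEquiv x)), ?_⟩
  ext i
  exact (e (x' i) ⟨i, rfl⟩).2.symm

end Occ

/-- The output law of the noisy permutation channel is Lipschitz in the type of the input. -/
lemma Channel.sum_abs_noisyPermutation_sub_le {A : Type*} [Fintype A] [DecidableEq A]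
    (U : Channel A A) {n : ℕ} {κ : ℝ}
    (hκ : ∀ (x : Fin n → A) (j : Fin n) (b : A), ∑ y, |(U.noisyPermutation n).prob x y -
        (U.noisyPermutation n).prob (Function.update x j b) y| ≤ κ) (m : ℕ) :
    ∀ x x' : Fin n → A, ∑ a, (occ x a - occ x' a) = m →
      ∑ y, |(U.noisyPermutation n).prob x y - (U.noisyPermutation n).prob x' y| ≤ m * κ := by
  induction m with
  | zero =>
    intro x x' h
    -- Subtraction is truncated, so the sum counts only excesses of `x`; as both totals are `n`, no
    -- excess forces equal types.
    have hle : ∀ a ∈ Finset.univ, occ x a ≤ occ x' a := fun a ha =>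
      Nat.sub_eq_zero_iff_le.1 (Finset.sum_eq_zero_iff.1 h a ha)
    have heq := (Finset.sum_eq_sum_iff_of_le hle).1 (by rw [sum_occ, sum_occ])
    obtain ⟨σ, rfl⟩ := exists_perm_of_occ_eq x x' fun a => heq a (Finset.mem_univ a)
    simp [U.noisyPermutation_comp_perm]
  | succ m ih =>
    intro x x' h
    -- Equal totals pair an excess of some `a` with a deficit of some `b`; turning one `a` into `b`
    -- lowers the total excess by one.
    obtain ⟨a, -, ha⟩ : ∃ a ∈ Finset.univ, occ x a - occ x' a ≠ 0 :=
      Finset.exists_ne_zero_of_sum_ne_zero (by omega)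
    obtain ⟨b, -, hb⟩ : ∃ b ∈ Finset.univ, occ x b < occ x' b := by
      by_contra! hle
      have heq := (Finset.sum_eq_sum_iff_of_le hle).1 (by rw [sum_occ, sum_occ])
      have := heq a (Finset.mem_univ a)
      omega
    obtain ⟨j, hj⟩ : ∃ j, x j = a := by
      have : 0 < occ x a := by omega
      obtain ⟨j, hj⟩ := Finset.card_pos.1 this
      exact ⟨j, by simpa using hj⟩
    have hsum : ∑ d, (occ (Function.update x j b) d - occ x' d) = m := by
      have hd : ∀ d ∈ Finset.univ, (occ (Function.update x j b) d - occ x' d) +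
          (if a = d then 1 else 0) = occ x d - occ x' d := by
        intro d _
        have hu := occ_update x j b d
        rw [hj] at hu
        by_cases h1 : a = d
        · subst h1
          have : b ≠ a := by
            rintro rfl
            omega
          simp only [this, if_true, if_false] at hu ⊢
          omega
        · by_cases h2 : b = d
          · subst h2
            simp only [h1, if_true, if_false] at hu ⊢
            omega
          · simp only [h1, h2, if_false] at hu ⊢
            omega
      have := Finset.sum_congr rfl hd
      rw [Finset.sum_add_distrib, h] at this
      simp at this
      omega
    calc _ ≤ ∑ y, (|(U.noisyPermutation n).prob x y -
        (U.noisyPermutation n).prob (Function.update x j b) y| +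
        |(U.noisyPermutation n).prob (Function.update x j b) y -
        (U.noisyPermutation n).prob x' y|) :=
        Finset.sum_le_sum fun y _ => abs_sub_le _ _ _
      _ ≤ κ + m * κ := by
        rw [Finset.sum_add_distrib]
        exact add_le_add (hκ x j b) (ih _ _ hsum)
      _ = _ := by push_cast; ring

/-! ### Error probabilities, and the pigeonhole bound for few input classes -/

namespace IDCode

variable {A B : Type*} [Fintype A] [Fintype B] {L : ℕ} (C : IDCode A B L) (P : Channel A B)

lemma enc_nonneg (i : Fin L) (x : A) : 0 ≤ (C.enc i : A → ℝ) x := (C.enc i).2.1 x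

lemma sum_enc (i : Fin L) : ∑ x, (C.enc i : A → ℝ) x = 1 := (C.enc i).2.2

lemma acceptProb_nonneg (i j : Fin L) : 0 ≤ C.acceptProb P i j :=
  Finset.sum_nonneg fun x _ => Finset.sum_nonneg fun y _ =>
    mul_nonneg (mul_nonneg (C.enc_nonneg i x) (P.nonneg x y)) ((C.dec j).nonneg y true)

lemma missProb_nonneg (i : Fin L) : 0 ≤ C.missProb P i :=
  Finset.sum_nonneg fun x _ => Finset.sum_nonneg fun y _ =>
    mul_nonneg (mul_nonneg (C.enc_nonneg i x) (P.nonneg x y)) ((C.dec i).nonneg y false)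

lemma acceptProb_le_one (i j : Fin L) : C.acceptProb P i j ≤ 1 := by
  calc C.acceptProb P i j ≤ ∑ x, ∑ y, (C.enc i : A → ℝ) x * P.prob x y :=
        Finset.sum_le_sum fun x _ => Finset.sum_le_sum fun y _ =>
          mul_le_of_le_one_right (mul_nonneg (C.enc_nonneg i x) (P.nonneg x y))
            ((C.dec j).prob_le_one y true)
    _ = 1 := by simp [← Finset.mul_sum, P.sum_eq_one, C.sum_enc]

lemma missProb_add_acceptProb (i : Fin L) : C.missProb P i + C.acceptProb P i i = 1 := by
  have h : ∀ y, (C.dec i).prob y false = 1 - (C.dec i).prob y true := fun y => by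
    have := (C.dec i).sum_eq_one y
    rw [Fintype.sum_bool] at this
    linarith
  simp only [missProb, acceptProb, ← Finset.sum_add_distrib, ← mul_add, h, sub_add_cancel, mul_one,
    ← Finset.mul_sum, P.sum_eq_one, C.sum_enc]

lemma missProb_le_typeI (i : Fin L) : C.missProb P i ≤ C.typeI P :=
  le_ciSup (Set.finite_range fun i => C.missProb P i).bddAbove i

lemma acceptProb_le_typeII {i j : Fin L} (h : i ≠ j) : C.acceptProb P i j ≤ C.typeII P :=
  le_ciSup (f := fun p : {p : Fin L × Fin L // p.1 ≠ p.2} => C.acceptProb P p.1.1 p.1.2)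
    (Set.finite_range _).bddAbove ⟨(i, j), h⟩

lemma typeI_nonneg : 0 ≤ C.typeI P := Real.iSup_nonneg fun i => C.missProb_nonneg P i

lemma typeII_nonneg : 0 ≤ C.typeII P := Real.iSup_nonneg fun _ => C.acceptProb_nonneg P _ _

lemma typeI_le {δ : ℝ} (hδ : 0 ≤ δ) (h : ∀ i, C.missProb P i ≤ δ) : C.typeI P ≤ δ :=
  Real.iSup_le h hδ

lemma typeII_le {δ : ℝ} (hδ : 0 ≤ δ) (h : ∀ i j, i ≠ j → C.acceptProb P i j ≤ δ) :
    C.typeII P ≤ δ :=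
  Real.iSup_le (fun p => h _ _ p.2) hδ

lemma typeI_le_one : C.typeI P ≤ 1 :=
  C.typeI_le P zero_le_one fun i => by
    linarith [C.missProb_add_acceptProb P i, C.acceptProb_nonneg P i i]

lemma typeII_le_one : C.typeII P ≤ 1 :=
  C.typeII_le P zero_le_one fun i j _ => C.acceptProb_le_one P i j

lemma acceptProb_eq (i j : Fin L) : C.acceptProb P i j =
    ∑ x, (C.enc i : A → ℝ) x * ∑ y, P.prob x y * (C.dec j).prob y true := by
  simp only [acceptProb, Finset.mul_sum, mul_assoc]

/-- If the inputs fall into few classes of nearly indistinguishable ones, then a code with many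
messages has large errors: two messages have nearly the same class distribution. -/
lemma le_typeI_add_typeII {K : Type*} [Fintype K] [DecidableEq K] (κ : A → K) {ε : ℝ}
    (hε : ∀ x x', κ x = κ x' → ∑ y, |P.prob x y - P.prob x' y| ≤ ε) (M : ℕ) (hM : 0 < M)
    (hL : (M + 1) ^ Fintype.card K < L) :
    1 - 2 * ε - Fintype.card K / M ≤ C.typeI P + C.typeII P := by
  have hM' : (0 : ℝ) < M := by exact_mod_cast hM
  set w : Fin L → K → ℝ := fun i k => ∑ x with κ x = k, (C.enc i : A → ℝ) x with hw
  have hw0 : ∀ i k, 0 ≤ w i k := fun i k => Finset.sum_nonneg fun x _ => C.enc_nonneg i x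
  have hw1 : ∀ i k, w i k ≤ 1 := fun i k => by
    rw [← C.sum_enc i]
    exact Finset.sum_le_sum_of_subset_of_nonneg (Finset.subset_univ _)
      fun x _ _ => C.enc_nonneg i x
  have hfl : ∀ i k, ⌊M * w i k⌋₊ < M + 1 := fun i k => by
    rw [Nat.lt_succ_iff]
    exact Nat.floor_le_of_le (mul_le_of_le_one_right hM'.le (hw1 i k))
  -- Two messages whose class weights agree after rounding down to multiples of `1 / M`.
  obtain ⟨i, j, hij, heq⟩ := Fintype.exists_ne_map_eq_of_card_lt
    (fun i : Fin L => fun k : K => (⟨⌊M * w i k⌋₊, hfl i k⟩ : Fin (M + 1))) (by simpa using hL)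
  have hclose : ∀ k, w j k - w i k ≤ 1 / M := by
    intro k
    have h1 : ⌊M * w i k⌋₊ = ⌊M * w j k⌋₊ := congrArg Fin.val (congrFun heq k)
    have h2 := Nat.floor_le (mul_nonneg hM'.le (hw0 i k))
    have h3 := Nat.lt_floor_add_one (M * w j k)
    rw [← h1] at h3
    rw [le_div_iff₀ hM']
    nlinarith
  have : Nonempty A := by
    by_contra hA
    have : IsEmpty A := not_nonempty_iff.1 hA
    simpa using C.sum_enc i
  set F : A → ℝ := fun x => ∑ y, P.prob x y * (C.dec j).prob y true with hF
  have hF0 : ∀ x, 0 ≤ F x := fun x => Finset.sum_nonneg fun y _ =>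
    mul_nonneg (P.nonneg x y) ((C.dec j).nonneg y true)
  have hF1 : ∀ x, F x ≤ 1 := fun x => by
    rw [← P.sum_eq_one x]
    exact Finset.sum_le_sum fun y _ =>
      mul_le_of_le_one_right (P.nonneg x y) ((C.dec j).prob_le_one y true)
  have hFε : ∀ x x', κ x = κ x' → |F x - F x'| ≤ ε := by
    intro x x' h
    refine le_trans ?_ (hε x x' h)
    simp only [hF, ← Finset.sum_sub_distrib, ← sub_mul]
    refine (Finset.abs_sum_le_sum_abs _ _).trans (Finset.sum_le_sum fun y _ => ?_)
    rw [abs_mul, abs_of_nonneg ((C.dec j).nonneg y true)]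
    exact mul_le_of_le_one_right (abs_nonneg _) ((C.dec j).prob_le_one y true)
  -- One representative per class; on classes containing no input its value is arbitrary and carries
  -- no weight.
  set r : K → A := Function.invFun κ with hr
  have hrκ : ∀ x, κ (r (κ x)) = κ x := fun x => Function.invFun_eq ⟨x, rfl⟩
  have hexp : ∀ l, ∑ x, (C.enc l : A → ℝ) x * F (r (κ x)) = ∑ k, w l k * F (r k) := by
    intro l
    rw [← Finset.sum_fiberwise (s := Finset.univ) (g := κ)]
    refine Finset.sum_congr rfl fun k _ => ?_
    rw [hw, Finset.sum_mul]
    refine Finset.sum_congr rfl fun x hx => ?_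
    rw [(Finset.mem_filter.1 hx).2]
  have hdev : ∀ l, |∑ x, (C.enc l : A → ℝ) x * F x - ∑ k, w l k * F (r k)| ≤ ε := by
    intro l
    rw [← hexp, ← Finset.sum_sub_distrib]
    simp only [← mul_sub]
    calc _ ≤ ∑ x, (C.enc l : A → ℝ) x * ε := by
          refine (Finset.abs_sum_le_sum_abs _ _).trans (Finset.sum_le_sum fun x _ => ?_)
          rw [abs_mul, abs_of_nonneg (C.enc_nonneg l x)]
          exact mul_le_mul_of_nonneg_left (hFε _ _ (hrκ x).symm) (C.enc_nonneg l x)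
      _ = ε := by rw [← Finset.sum_mul, C.sum_enc, one_mul]
  have hw_sum : ∑ k, w j k * F (r k) - ∑ k, w i k * F (r k) ≤ Fintype.card K / M := by
    rw [← Finset.sum_sub_distrib]
    calc _ ≤ ∑ _k : K, (1 / M : ℝ) := Finset.sum_le_sum fun k _ => by
          rw [← sub_mul]
          have h1 : (w j k - w i k) * F (r k) ≤ 1 / M * F (r k) :=
            mul_le_mul_of_nonneg_right (hclose k) (hF0 _)
          exact h1.trans (mul_le_of_le_one_right (by positivity) (hF1 _))
      _ = _ := by simp [div_eq_mul_inv]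
  have h1 := C.missProb_le_typeI P j
  have h2 := C.acceptProb_le_typeII P hij
  have h3 := C.missProb_add_acceptProb P j
  rw [acceptProb_eq] at h2 h3
  have h4 := abs_le.1 (hdev i)
  have h5 := abs_le.1 (hdev j)
  linarith [h4.1, h4.2, h5.1, h5.2]

end IDCode

/-! ### Classes of rounded types -/

section TypeClass

variable {A : Type*} [Fintype A] [DecidableEq A] {n : ℕ}

/-- The numbers of occurrences of all symbols but one, rounded down to multiples of `s`. -/
def typeClass (a₀ : A) (s : ℕ) (x : Fin n → A) : {a // a ≠ a₀} → Fin (n / s + 1) :=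
  fun a => ⟨occ x a / s, Nat.lt_succ_of_le (Nat.div_le_div_right (occ_le x a))⟩

lemma card_typeClass (a₀ : A) (s : ℕ) :
    Fintype.card ({a // a ≠ a₀} → Fin (n / s + 1)) = (n / s + 1) ^ (Fintype.card A - 1) := by
  simp [Fintype.card_subtype_compl]

/-- Counts of symbols other than `a₀` differ by at most `s`; the count of `a₀` is `n` minus the
others, so its excess is at most `Fintype.card A * s`. -/
lemma sum_occ_sub_le_of_typeClass_eq (a₀ : A) {s : ℕ} (hs : 0 < s) (x x' : Fin n → A)
    (h : typeClass a₀ s x = typeClass a₀ s x') :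
    ∑ a, (occ x a - occ x' a) ≤ 2 * Fintype.card A * s := by
  have hdiv : ∀ a, a ≠ a₀ → occ x a / s = occ x' a / s := fun a ha =>
    congrArg Fin.val (congrFun h ⟨a, ha⟩)
  have hle : ∀ a, a ≠ a₀ → occ x a ≤ occ x' a + s ∧ occ x' a ≤ occ x a + s := by
    intro a ha
    have h1 := Nat.div_add_mod (occ x a) s
    have h2 := Nat.div_add_mod (occ x' a) s
    have h3 := Nat.mod_lt (occ x a) hs
    have h4 := Nat.mod_lt (occ x' a) hs
    rw [hdiv a ha] at h1
    omega
  have h1 : ∑ a ∈ Finset.univ.erase a₀, (occ x a - occ x' a) ≤ Fintype.card A * s := by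
    calc _ ≤ ∑ a ∈ Finset.univ.erase a₀, s := Finset.sum_le_sum fun a ha => by
          have := hle a (Finset.ne_of_mem_erase ha)
          omega
      _ ≤ _ := by
          rw [Finset.sum_const, smul_eq_mul]
          exact Nat.mul_le_mul_right _ (Finset.card_le_univ _)
  have h2 : ∑ a ∈ Finset.univ.erase a₀, occ x' a ≤
      ∑ a ∈ Finset.univ.erase a₀, occ x a + Fintype.card A * s := by
    calc _ ≤ ∑ a ∈ Finset.univ.erase a₀, (occ x a + s) := Finset.sum_le_sum fun a ha =>
          (hle a (Finset.ne_of_mem_erase ha)).2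
      _ ≤ _ := by
          rw [Finset.sum_add_distrib, Finset.sum_const, smul_eq_mul]
          exact Nat.add_le_add_left (Nat.mul_le_mul_right _ (Finset.card_le_univ _)) _
  have h3 := sum_occ x
  have h4 := sum_occ x'
  rw [← Finset.add_sum_erase _ _ (Finset.mem_univ a₀)] at h3 h4 ⊢
  have : 2 * Fintype.card A * s = Fintype.card A * s + Fintype.card A * s := by ring
  omega

/-- Inputs of the same class have nearly the same output law. -/
lemma Channel.exists_sum_abs_le_of_typeClass_eq (U : Channel A A) (hU : ∀ a b, 0 < U.prob a b) :
    ∃ D : ℝ, 0 < D ∧ ∀ (n : ℕ) (a₀ : A) (s : ℕ), 0 < s → ∀ x x' : Fin n → A,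
      typeClass a₀ s x = typeClass a₀ s x' →
      ∑ y, |(U.noisyPermutation n).prob x y - (U.noisyPermutation n).prob x' y| ≤
        D * (s / √n) := by
  obtain ⟨G, hG⟩ := (Set.finite_range fun p : A × A × A =>
    (U.prob p.1 p.2.2 / U.prob p.2.1 p.2.2 - 1) ^ 2).bddAbove
  have hG' : ∀ a c b, (U.prob a b / U.prob c b - 1) ^ 2 ≤ |G| := fun a c b =>
    (hG ⟨(a, c, b), rfl⟩).trans (le_abs_self G)
  -- The final `+ 1` keeps the constant positive even for an empty alphabet.
  refine ⟨2 * Fintype.card A * (2 * (|G| + 1) * √(Fintype.card A)) + 1, by positivity, ?_⟩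
  intro n a₀ s hs x x' h
  have h1 := U.sum_abs_noisyPermutation_sub_le
    (fun x j b => U.sum_abs_noisyPermutation_sub_update_le_sqrt hU hG' x j b) _ x x' rfl
  have h2 : ((∑ a, (occ x a - occ x' a) : ℕ) : ℝ) ≤ 2 * Fintype.card A * s := by
    exact_mod_cast sum_occ_sub_le_of_typeClass_eq a₀ hs x x' h
  refine h1.trans ((mul_le_mul_of_nonneg_right h2 (by positivity)).trans ?_)
  have h3 : (0 : ℝ) ≤ s / √n := by positivity
  calc _ = 2 * Fintype.card A * (2 * (|G| + 1) * √(Fintype.card A)) * (s / √n) := by ring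
    _ ≤ _ := by gcongr; linarith

end TypeClass

lemma card_typeClass_le {n q : ℕ} {η : ℝ} (hn : 1 ≤ n) (hq : 1 ≤ q) (hη : 0 < η) :
    (((n / ⌈η * √n⌉₊ + 1) ^ (q - 1) : ℕ) : ℝ) ≤
      (1 / η + 1) ^ (q - 1) * (n : ℝ) ^ (((q : ℝ) - 1) / 2) := by
  have hn' : (1 : ℝ) ≤ n := by exact_mod_cast hn
  have hs1 : 1 ≤ √(n : ℝ) := Real.one_le_sqrt.2 hn'
  have hpos : 0 < √(n : ℝ) := by linarith
  have h1 : ((n / ⌈η * √n⌉₊ : ℕ) : ℝ) ≤ √n / η := by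
    refine Nat.cast_div_le.trans ?_
    calc (n : ℝ) / ⌈η * √n⌉₊ ≤ n / (η * √n) := by
          gcongr
          exact Nat.le_ceil _
      _ = √n / η := by
          rw [div_eq_div_iff (by positivity) hη.ne']
          nlinarith [Real.mul_self_sqrt (by linarith : (0 : ℝ) ≤ n)]
  have h2 : (n : ℝ) ^ (((q : ℝ) - 1) / 2) = √n ^ (q - 1) := by
    rw [Real.sqrt_eq_rpow, ← Real.rpow_natCast, ← Real.rpow_mul (by linarith), Nat.cast_sub hq]
    congr 1
    push_cast
    ring
  rw [h2, ← mul_pow]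
  push_cast
  gcongr
  calc ((n / ⌈η * √n⌉₊ : ℕ) : ℝ) + 1 ≤ √n / η + √n := by linarith
    _ = _ := by ring

/-! ### The strong converse -/

/-- Quantitative form of the strong converse. -/
lemma exists_forall_le_typeI_add_typeII (q : ℕ) (hq : 2 ≤ q) (U : Channel (Fin q) (Fin q))
    (hU : ∀ a b, 0 < U.prob a b) {δ : ℝ} (hδ : 0 < δ) :
    ∃ (n₀ : ℕ) (c₀ : ℝ), ∀ (n : ℕ) (c : ℝ) (L : ℕ), n₀ ≤ n → c₀ ≤ c →
      ⌊(2 : ℝ) ^ (c * (n : ℝ) ^ (((q : ℝ) - 1) / 2) *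
          (Real.logb 2 n) ^ (1 + ((q : ℝ) - 1) * ((q : ℝ) - 2) / 2))⌋₊ ≤ L →
      ∀ C : IDCode (Fin n → Fin q) (Fin n → Fin q) L,
        1 - δ ≤ C.typeI (U.noisyPermutation n) + C.typeII (U.noisyPermutation n) := by
  obtain ⟨D, hD, hU'⟩ := U.exists_sum_abs_le_of_typeClass_eq hU
  -- Spacing `η√n` costs `δ / 8` and rounding it up costs `D / √n ≤ δ / 8`, so class diameters are
  -- at most `δ / 4`; they enter the error bound twice.
  set η : ℝ := δ / (8 * D) with hη
  have hηpos : 0 < η := by positivity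
  set E : ℝ := (1 / η + 1) ^ (q - 1) with hE
  have hEpos : 0 < E := by positivity
  have hev : ∀ᶠ n : ℕ in atTop, 2 ≤ n ∧ D / √(n : ℝ) ≤ δ / 8 ∧ (2 : ℝ) ^ q / δ ≤ n := by
    refine (eventually_ge_atTop 2).and (Eventually.and ?_ ?_)
    · have : Tendsto (fun n : ℕ => D / √(n : ℝ)) atTop (𝓝 0) :=
        tendsto_const_nhds.div_atTop
          (Real.tendsto_sqrt_atTop.comp tendsto_natCast_atTop_atTop)
      exact this.eventually_le_const (by positivity)
    · exact tendsto_natCast_atTop_atTop.eventually_ge_atTop _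
  obtain ⟨n₀, hn₀⟩ := eventually_atTop.1 hev
  -- `(q + 1) * E` comes from `M + 1 ≤ n ^ (q + 1)` and the bound on `N`; the extra 1 pays for the
  -- floor and the strict inequality.
  refine ⟨n₀, (q + 1) * E + 1, fun n c L hn hc hL C => ?_⟩
  obtain ⟨hn2, hnD, hnδ⟩ := hn₀ n hn
  have hn2' : (2 : ℝ) ≤ n := by exact_mod_cast hn2
  have hsq : 0 < √(n : ℝ) := Real.sqrt_pos.2 (by linarith)
  set s := ⌈η * √n⌉₊ with hs
  have hspos : 0 < s := Nat.ceil_pos.2 (by positivity)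
  set N := (n / s + 1) ^ (q - 1) with hN
  have hNE : (N : ℝ) ≤ E * (n : ℝ) ^ (((q : ℝ) - 1) / 2) :=
    card_typeClass_le (by omega) (by omega) hηpos
  -- Fine enough for `N / M → 0`, since `N ≤ (2n) ^ (q - 1)`, yet `log M` is only of order `log n`.
  set M := n ^ q with hM
  have hMpos : 0 < M := by positivity
  have hcard : Fintype.card ({a : Fin q // a ≠ ⟨0, by omega⟩} → Fin (n / s + 1)) = N := by
    rw [card_typeClass, Fintype.card_fin]
  have hε : ∀ x x' : Fin n → Fin q, typeClass ⟨0, by omega⟩ s x = typeClass ⟨0, by omega⟩ s x' →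
      ∑ y, |(U.noisyPermutation n).prob x y - (U.noisyPermutation n).prob x' y| ≤ δ / 4 := by
    intro x x' h
    refine (hU' n _ s hspos x x' h).trans ?_
    have h1 : (s : ℝ) ≤ η * √n + 1 := (Nat.ceil_lt_add_one (by positivity)).le
    calc D * (s / √n) ≤ D * ((η * √n + 1) / √n) := by gcongr
      _ = δ / 8 + D / √n := by
          rw [hη]
          field_simp
      _ ≤ δ / 4 := by linarith
  have hNM : (N : ℝ) / M ≤ δ / 2 := by
    have h1 : N ≤ (2 * n) ^ (q - 1) := by
      refine Nat.pow_le_pow_left ?_ _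
      have := Nat.div_le_self n s
      omega
    have h1' : (N : ℝ) ≤ (2 * n) ^ (q - 1) := by exact_mod_cast h1
    obtain ⟨p, rfl⟩ : ∃ p, q = p + 1 := ⟨q - 1, by omega⟩
    rw [hM, div_le_iff₀ (by positivity)]
    rw [div_le_iff₀ hδ, pow_succ] at hnδ
    push_cast
    simp only [Nat.add_sub_cancel, mul_pow] at h1'
    refine h1'.trans ?_
    rw [pow_succ]
    have : (0 : ℝ) < (n : ℝ) ^ p := by positivity
    nlinarith
  have hlog : 1 ≤ Real.logb 2 n := by
    rw [Real.le_logb_iff_rpow_le (by norm_num) (by linarith)]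
    simpa using hn2'
  have hcount : (M + 1) ^ N < L := by
    refine lt_of_lt_of_le (Nat.lt_of_succ_le (Nat.le_floor ?_)) hL
    have h1 : ((M : ℝ) + 1) ≤ (n : ℝ) ^ (q + 1) := by
      have : (1 : ℝ) ≤ (n : ℝ) ^ q := one_le_pow₀ (by linarith)
      rw [hM, pow_succ]
      push_cast
      nlinarith
    have h2 : ((M : ℝ) + 1) ^ N ≤ (2 : ℝ) ^ ((q + 1) * N * Real.logb 2 n) := by
      calc ((M : ℝ) + 1) ^ N ≤ ((n : ℝ) ^ (q + 1)) ^ N := by gcongr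
        _ = (2 : ℝ) ^ ((q + 1) * N * Real.logb 2 n) := by
          rw [mul_comm _ (Real.logb 2 n), Real.rpow_mul (by norm_num),
            Real.rpow_logb (by norm_num) (by norm_num) (by linarith), ← pow_mul,
            ← Real.rpow_natCast]
          push_cast
          rfl
    have h3 : (1 : ℝ) ≤ ((M : ℝ) + 1) ^ N := one_le_pow₀ (by linarith [(Nat.cast_nonneg M : (0:ℝ) ≤ M)])
    have hn1 : 1 ≤ (n : ℝ) ^ (((q : ℝ) - 1) / 2) := by
      refine Real.one_le_rpow (by linarith) ?_
      have : (2 : ℝ) ≤ q := by exact_mod_cast hq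
      linarith
    -- The counting needs just one power of the logarithm; the rest of the exponent is given away
    -- here.
    have hl1 : Real.logb 2 n ≤ Real.logb 2 n ^ (1 + ((q : ℝ) - 1) * ((q : ℝ) - 2) / 2) := by
      have : (2 : ℝ) ≤ q := by exact_mod_cast hq
      have h0 : 0 ≤ ((q : ℝ) - 1) * ((q : ℝ) - 2) / 2 := by
        refine div_nonneg (mul_nonneg ?_ ?_) (by norm_num) <;> linarith
      calc Real.logb 2 n = Real.logb 2 n ^ (1 : ℝ) := (Real.rpow_one _).symm
        _ ≤ _ := Real.rpow_le_rpow_of_exponent_le hlog (by linarith)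
    set Z := (n : ℝ) ^ (((q : ℝ) - 1) / 2) with hZ
    have hexp : 1 + (q + 1) * N * Real.logb 2 n ≤
        c * Z * (Real.logb 2 n) ^ (1 + ((q : ℝ) - 1) * ((q : ℝ) - 2) / 2) := by
      calc 1 + (q + 1) * N * Real.logb 2 n
          ≤ Z * Real.logb 2 n + (q + 1) * (E * Z) * Real.logb 2 n := by
            gcongr
            nlinarith
        _ = ((q + 1) * E + 1) * Z * Real.logb 2 n := by ring
        _ ≤ _ := by
            gcongr
            exact mul_nonneg (le_trans (by positivity) hc) (by linarith)
    calc (((M + 1) ^ N).succ : ℝ) = ((M : ℝ) + 1) ^ N + 1 := by push_cast; rfl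
      _ ≤ 2 * ((M : ℝ) + 1) ^ N := by linarith
      _ ≤ 2 * (2 : ℝ) ^ ((q + 1) * N * Real.logb 2 n) := by gcongr
      _ = (2 : ℝ) ^ (1 + (q + 1) * N * Real.logb 2 n) := by
          rw [Real.rpow_add (by norm_num), Real.rpow_one]
      _ ≤ _ := Real.rpow_le_rpow_of_exponent_le (by norm_num) hexp
  have hmain := C.le_typeI_add_typeII (U.noisyPermutation n) (typeClass ⟨0, by omega⟩ s) hε M hMpos
    (by rw [hcard]; exact hcount)
  rw [hcard] at hmain
  linarith

theorem strong_converse (q : ℕ) (hq : 2 ≤ q) (U : Channel (Fin q) (Fin q))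
    (hU : ∀ a b, 0 < U.prob a b) (n : ℕ → ℕ) (c : ℕ → ℝ) (hn : Tendsto n atTop atTop)
    (hc : Tendsto c atTop atTop) (L : ℕ → ℕ)
    (hL : ∀ i, ⌊(2 : ℝ) ^ (c i * (n i : ℝ) ^ (((q : ℝ) - 1) / 2) *
          (Real.logb 2 (n i)) ^ (1 + ((q : ℝ) - 1) * ((q : ℝ) - 2) / 2))⌋₊ ≤ L i)
    (C : (i : ℕ) → IDCode (Fin (n i) → Fin q) (Fin (n i) → Fin q) (L i)) :
    1 ≤ liminf (fun i => (C i).typeI (U.noisyPermutation (n i)) +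
          (C i).typeII (U.noisyPermutation (n i))) atTop := by
  refine le_of_forall_sub_le fun δ hδ => ?_
  obtain ⟨n₀, c₀, h⟩ := exists_forall_le_typeI_add_typeII q hq U hU hδ
  refine le_liminf_of_le ?_ ?_
  -- A lower bound on a real `liminf` needs coboundedness, supplied by the trivial bound 2.
  · refine IsBoundedUnder.isCoboundedUnder_ge (isBoundedUnder_of ⟨2, fun i => ?_⟩)
    linarith [(C i).typeI_le_one (U.noisyPermutation (n i)),
      (C i).typeII_le_one (U.noisyPermutation (n i))]
  · filter_upwards [hn.eventually_ge_atTop n₀, hc.eventually_ge_atTop c₀] with i h1 h2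
    exact h (n i) (c i) (L i) h1 h2 (hL i) (C i)

/-! ### Words with few agreements -/

/-- Greedy choice of points which pairwise avoid a symmetric relation. -/
lemma exists_pairwise_not {X : Type*} [Fintype X] (R : X → X → Prop) [DecidableRel R]
    (hR : ∀ x y, R x y → R y x) (D : ℕ) (hD : ∀ x, (Finset.univ.filter (R x)).card ≤ D) (L : ℕ)
    (hL : L * D < Fintype.card X + D) :
    ∃ f : Fin L → X, ∀ i j, i ≠ j → ¬ R (f i) (f j) := by
  classical
  induction L with
  | zero => exact ⟨Fin.elim0, fun i => i.elim0⟩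
  | succ L ih =>
    have hL' : L * D < Fintype.card X := by
      rw [Nat.succ_mul] at hL
      omega
    obtain ⟨f, hf⟩ := ih (by omega)
    obtain ⟨z, hz⟩ : ∃ z, z ∉ Finset.univ.biUnion fun i => Finset.univ.filter (R (f i)) := by
      by_contra! hall
      have h1 : (Finset.univ.biUnion fun i => Finset.univ.filter (R (f i))).card ≤ L * D := by
        refine Finset.card_biUnion_le.trans ?_
        simpa using Finset.sum_le_sum fun (i : Fin L) (_ : i ∈ Finset.univ) => hD (f i)
      rw [Finset.eq_univ_iff_forall.2 hall, Finset.card_univ] at h1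
      omega
    have hz' : ∀ i, ¬ R (f i) z := by simpa using hz
    refine ⟨Fin.snoc f z, fun i j hij => ?_⟩
    induction i using Fin.lastCases with
    | last =>
      induction j using Fin.lastCases with
      | last => exact absurd rfl hij
      | cast j => simpa using fun h => hz' j (hR _ _ h)
    | cast i =>
      induction j using Fin.lastCases with
      | last => simpa using hz' i
      | cast j => simpa using hf i j fun h => hij (by rw [h])

/-- The number of coordinates where two words agree. -/
def agreement {M : ℕ} {B : Type*} [DecidableEq B] (f g : Fin M → B) : Finset (Fin M) :=
  Finset.univ.filter fun m => f m = g m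

/-- Union bound over the at most `2 ^ M` agreement sets `T`: `g` is fixed on `T` and free elsewhere,
and `k * |T| ≥ M` bounds the free choices by `4 ^ (k * M - M)`. -/
lemma card_filter_agreement_le (M k : ℕ) (f : Fin M → Fin (4 ^ k)) :
    (Finset.univ.filter fun g : Fin M → Fin (4 ^ k) => M ≤ k * (agreement f g).card).card ≤
      2 ^ M * 4 ^ (k * M - M) := by
  have hsub : (Finset.univ.filter fun g : Fin M → Fin (4 ^ k) => M ≤ k * (agreement f g).card) ⊆
      (Finset.univ.filter fun T : Finset (Fin M) => M ≤ k * T.card).biUnion fun T =>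
        Fintype.piFinset fun m => if m ∈ T then {f m} else Finset.univ := by
    intro g hg
    simp only [Finset.mem_biUnion, Finset.mem_filter, Finset.mem_univ, true_and] at hg ⊢
    refine ⟨_, hg, ?_⟩
    rw [Fintype.mem_piFinset]
    intro m
    by_cases h : f m = g m <;> simp [agreement, h]
  refine (Finset.card_le_card hsub).trans (Finset.card_biUnion_le.trans ?_)
  have hT : ∀ T ∈ Finset.univ.filter (fun T : Finset (Fin M) => M ≤ k * T.card),
      (Fintype.piFinset fun m => if m ∈ T then {f m} else
        (Finset.univ : Finset (Fin (4 ^ k)))).card ≤ 4 ^ (k * M - M) := by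
    intro T hT
    have hT' : M ≤ k * T.card := by simpa using hT
    have h1 : ∀ m, (if m ∈ T then {f m} else (Finset.univ : Finset (Fin (4 ^ k)))).card =
        if m ∈ Tᶜ then 4 ^ k else 1 := fun m => by
      by_cases h : m ∈ T <;> simp [h]
    rw [Fintype.card_piFinset, Finset.prod_congr rfl fun m _ => h1 m, Finset.prod_ite_mem,
      Finset.univ_inter, Finset.prod_const, ← pow_mul, Finset.card_compl, Fintype.card_fin]
    refine Nat.pow_le_pow_right (by norm_num) ?_
    rw [Nat.mul_sub]
    omega
  refine (Finset.sum_le_sum hT).trans ?_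
  rw [Finset.sum_const, smul_eq_mul]
  refine Nat.mul_le_mul_right _ ((Finset.card_le_univ _).trans ?_)
  simp

/-- A Gilbert–Varshamov bound: exponentially many words with few pairwise agreements. -/
lemma exists_small_agreement (M k L : ℕ) (hk : 1 ≤ k) (hL : L ≤ 2 ^ M) :
    ∃ f : Fin L → Fin M → Fin (4 ^ k),
      ∀ i j, i ≠ j → k * (agreement (f i) (f j)).card < M := by
  obtain ⟨f, hf⟩ := exists_pairwise_not
    (fun f g : Fin M → Fin (4 ^ k) => M ≤ k * (agreement f g).card)
    (fun f g h => by simpa only [agreement, eq_comm] using h)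
    (2 ^ M * 4 ^ (k * M - M)) (card_filter_agreement_le M k) L (by
      have hkM : M ≤ k * M := Nat.le_mul_of_pos_left M hk
      -- The saved factor `4 ^ M = 2 ^ M * 2 ^ M` pays once for the agreement sets and once for the
      -- number of greedy steps.
      have h1 : (2 : ℕ) ^ M * (2 ^ M * 4 ^ (k * M - M)) = Fintype.card (Fin M → Fin (4 ^ k)) := by
        rw [← mul_assoc, ← mul_pow, Fintype.card_pi]
        simp only [Fintype.card_fin, Finset.prod_const, Finset.card_univ]
        rw [show 2 * 2 = 4 from rfl, ← pow_mul, ← pow_add]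
        congr 1
        omega
      have h2 := Nat.mul_le_mul_right (2 ^ M * 4 ^ (k * M - M)) hL
      have h3 : 0 < 2 ^ M * 4 ^ (k * M - M) := by positivity
      omega)
  exact ⟨f, fun i j hij => not_le.1 (hf i j hij)⟩

/-! ### Identification codes from reliably decodable inputs -/

section Construction

variable {A B : Type*} [Fintype A] [Fintype B] [DecidableEq B]

lemma DetDecIDCode.acceptProb_toIDCode {L : ℕ} (C : DetDecIDCode A B L) (P : Channel A B)
    (i j : Fin L) : C.toIDCode.acceptProb P i j =
      ∑ x, (C.enc i : A → ℝ) x * ∑ y ∈ C.acc j, P.prob x y := by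
  rw [IDCode.acceptProb_eq]
  refine Finset.sum_congr rfl fun x _ => ?_
  simp [DetDecIDCode.toIDCode, decisionRule]

variable [DecidableEq A]

/-- The uniform distribution on the inputs `u 0, …, u (M - 1)`, listed with multiplicity. -/
noncomputable def uniformOn {M : ℕ} (hM : 0 < M) (u : Fin M → A) : stdSimplex ℝ A :=
  ⟨fun x => (1 / (M : ℝ)) * ∑ m, if u m = x then 1 else 0,
    fun x => mul_nonneg (by positivity) (Finset.sum_nonneg fun m _ => by split_ifs <;> norm_num),
    by
      have : (M : ℝ) ≠ 0 := by positivity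
      rw [← Finset.mul_sum, Finset.sum_comm]
      simp [this]⟩

lemma sum_uniformOn_mul {M : ℕ} (hM : 0 < M) (u : Fin M → A) (F : A → ℝ) :
    ∑ x, (uniformOn hM u : A → ℝ) x * F x = (1 / (M : ℝ)) * ∑ m, F (u m) := by
  change ∑ x, ((1 / (M : ℝ)) * ∑ m, if u m = x then 1 else 0) * F x = _
  simp only [mul_assoc, ← Finset.mul_sum, Finset.sum_mul]
  rw [Finset.sum_comm]
  simp

/-- From reliably decodable inputs and words with few agreements to an identification code. -/
lemma exists_detDecIDCode (P : Channel A B) {M K L : ℕ} (hM : 0 < M) (u : Fin M × Fin K → A)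
    (E : Fin M × Fin K → Finset B) (hE : ∀ a b, a ≠ b → Disjoint (E a) (E b)) {δ : ℝ}
    (hδ : 0 ≤ δ) (hu : ∀ a, 1 - δ ≤ ∑ y ∈ E a, P.prob (u a) y) {k : ℕ} (hk : 1 ≤ k)
    (f : Fin L → Fin M → Fin K) (hf : ∀ i j, i ≠ j → k * (agreement (f i) (f j)).card < M) :
    ∃ C : DetDecIDCode A B L, C.toIDCode.typeI P ≤ δ ∧ C.toIDCode.typeII P ≤ 1 / k + δ := by
  have hM' : (0 : ℝ) < M := by exact_mod_cast hM
  have hk' : (0 : ℝ) < k := by exact_mod_cast hk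
  -- Message `i` is sent as a random point of the graph of `f i`, and decoder `i` accepts whatever
  -- decodes to a point of this graph.
  set C : DetDecIDCode A B L :=
    ⟨fun i => uniformOn hM fun m => u (m, f i m),
      fun i => Finset.univ.biUnion fun m => E (m, f i m)⟩ with hC
  have hacc : ∀ i j, C.toIDCode.acceptProb P i j =
      (1 / (M : ℝ)) * ∑ m, ∑ y ∈ C.acc j, P.prob (u (m, f i m)) y := by
    intro i j
    rw [DetDecIDCode.acceptProb_toIDCode]
    exact sum_uniformOn_mul hM _ _
  have hsub : ∀ i m, E (m, f i m) ⊆ C.acc i := fun i m =>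
    Finset.subset_biUnion_of_mem (fun m => E (m, f i m)) (Finset.mem_univ m)
  refine ⟨C, C.toIDCode.typeI_le P hδ fun i => ?_, C.toIDCode.typeII_le P (by positivity) ?_⟩
  · have h1 := C.toIDCode.missProb_add_acceptProb P i
    have h2 : 1 - δ ≤ C.toIDCode.acceptProb P i i := by
      rw [hacc]
      calc 1 - δ = (1 / (M : ℝ)) * ∑ _m : Fin M, (1 - δ) := by
            simp only [Finset.sum_const, Finset.card_univ, Fintype.card_fin, nsmul_eq_mul]
            field_simp
        _ ≤ _ := by
            gcongr with m
            exact (hu (m, f i m)).trans (Finset.sum_le_sum_of_subset_of_nonneg (hsub i m)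
              fun y _ _ => P.nonneg _ y)
    linarith
  · intro i j hij
    rw [hacc]
    have hm : ∀ m ∈ Finset.univ, ∑ y ∈ C.acc j, P.prob (u (m, f i m)) y ≤
        (if m ∈ agreement (f i) (f j) then 1 else 0) + δ := by
      intro m _
      by_cases h : f i m = f j m
      · have : m ∈ agreement (f i) (f j) := by simp [agreement, h]
        rw [if_pos this]
        have : ∑ y ∈ C.acc j, P.prob (u (m, f i m)) y ≤ 1 := by
          rw [← P.sum_eq_one (u (m, f i m))]
          exact Finset.sum_le_sum_of_subset_of_nonneg (Finset.subset_univ _)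
            fun y _ _ => P.nonneg _ y
        linarith
      · have h' : m ∉ agreement (f i) (f j) := by simp [agreement, h]
        rw [if_neg h', zero_add]
        -- The point `(m, f i m)` lies off the graph of `f j`, so acceptance by `j` requires a
        -- decoding error.
        have hdisj : Disjoint (E (m, f i m)) (C.acc j) := by
          rw [Finset.disjoint_biUnion_right]
          intro m' _
          refine hE _ _ fun heq => h ?_
          rw [Prod.mk.injEq] at heq
          rw [heq.2, heq.1]
        have h1 : ∑ y ∈ E (m, f i m), P.prob (u (m, f i m)) y +
            ∑ y ∈ C.acc j, P.prob (u (m, f i m)) y ≤ 1 := by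
          rw [← Finset.sum_union hdisj, ← P.sum_eq_one (u (m, f i m))]
          exact Finset.sum_le_sum_of_subset_of_nonneg (Finset.subset_univ _)
            fun y _ _ => P.nonneg _ y
        linarith [hu (m, f i m)]
    have hcard : ((agreement (f i) (f j)).card : ℝ) ≤ M / k := by
      rw [le_div_iff₀ hk', mul_comm]
      exact_mod_cast (hf i j hij).le
    calc _ ≤ (1 / (M : ℝ)) * ∑ m, ((if m ∈ agreement (f i) (f j) then 1 else 0) + δ) := by
          gcongr with m
          exact hm m (Finset.mem_univ m)
      _ = (1 / (M : ℝ)) * ((agreement (f i) (f j)).card + M * δ) := by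
          rw [Finset.sum_add_distrib]
          simp
      _ ≤ (1 / (M : ℝ)) * (M / k + M * δ) := by gcongr
      _ = 1 / k + δ := by field_simp

end Construction

/-! ### Decoding input types from output types -/

/-- Words with prescribed numbers of occurrences. -/
lemma exists_occ_eq {α : Type*} [Fintype α] [DecidableEq α] {n : ℕ} (k : α → ℕ)
    (hk : ∑ a, k a = n) : ∃ v : Fin n → α, ∀ a, occ v a = k a := by
  have e : Fin n ≃ Σ a, Fin (k a) := Fintype.equivOfCardEq (by simp [hk])
  refine ⟨fun i => (e i).1, fun a => ?_⟩
  have : occ (fun i => (e i).1) a = (Finset.univ.filter fun p : Σ a, Fin (k a) => p.1 = a).card := by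
    simp only [occ, Finset.card_filter]
    exact Equiv.sum_comp e fun p => if p.1 = a then 1 else 0
  rw [this, ← Fintype.card_subtype, Fintype.card_congr (Equiv.sigmaSubtype a), Fintype.card_fin]

lemma sum_comp_eq_sum_occ {α : Type*} [Fintype α] [DecidableEq α] {n : ℕ} (v : Fin n → α)
    (F : α → ℝ) : ∑ i, F (v i) = ∑ a, occ v a * F a := by
  rw [← Finset.sum_fiberwise (s := Finset.univ) (g := v)]
  refine Finset.sum_congr rfl fun a _ => ?_
  rw [Finset.sum_congr rfl fun i hi => by rw [(Finset.mem_filter.1 hi).2]]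
  simp [occ]

namespace Channel

variable {A : Type*} [Fintype A] [DecidableEq A] (U : Channel A A) {n : ℕ}

/-- Chebyshev's inequality for the output type. -/
lemma le_sum_noisyPermutation (x : Fin n → A) {t : ℝ} (ht : 0 < t) (E : Finset (Fin n → A))
    (hE : ∀ y, y ∈ E ↔ ∀ b, |(occ y b : ℝ) - ∑ i, U.prob (x i) b| < t) :
    1 - Fintype.card A * (n / t ^ 2) ≤ ∑ y ∈ E, (U.noisyPermutation n).prob x y := by
  -- The event depends on the output type only, so the permutation can be dropped and the
  -- coordinates are independent.
  have hsym : ∀ (σ : Equiv.Perm (Fin n)) (y : Fin n → A),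
      (if y ∘ σ ∈ E then (1 : ℝ) else 0) = if y ∈ E then 1 else 0 := by
    intro σ y
    simp only [hE, occ_comp_perm]
  have h1 : ∑ y ∈ E, (U.noisyPermutation n).prob x y =
      ∑ y, (U.memoryless n).prob x y * if y ∈ E then 1 else 0 := by
    rw [← sum_noisyPermutation_mul U x _ hsym]
    simp
  have hvar : ∀ b, ∑ y, (U.memoryless n).prob x y *
      ((occ y b : ℝ) - ∑ i, U.prob (x i) b) ^ 2 ≤ n := by
    intro b
    have hocc : ∀ y : Fin n → A, (occ y b : ℝ) - ∑ i, U.prob (x i) b =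
        ∑ i, ((if y i = b then 1 else 0) - U.prob (x i) b) := by
      intro y
      rw [Finset.sum_sub_distrib]
      simp [occ]
    simp only [hocc, memoryless_prob]
    rw [sum_prod_mul_sum_sq (fun i => U.prob (x i)) (fun i => U.sum_eq_one _)
      (fun i a => (if a = b then 1 else 0) - U.prob (x i) b) (fun i => by
        simp [mul_sub, Finset.sum_sub_distrib, ← Finset.sum_mul, U.sum_eq_one])]
    calc _ ≤ ∑ i, ∑ a, U.prob (x i) a * 1 := by
          gcongr with i _ a
          · exact U.nonneg _ _
          · have h0 := U.nonneg (x i) b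
            have h1 := U.prob_le_one (x i) b
            split_ifs <;> nlinarith
      _ = n := by simp [U.sum_eq_one]
  have hpt : ∀ y, 1 - ∑ b, ((occ y b : ℝ) - ∑ i, U.prob (x i) b) ^ 2 / t ^ 2 ≤
      if y ∈ E then 1 else 0 := by
    intro y
    have hnn : ∀ b ∈ Finset.univ, 0 ≤ ((occ y b : ℝ) - ∑ i, U.prob (x i) b) ^ 2 / t ^ 2 :=
      fun b _ => by positivity
    split_ifs with h
    · linarith [Finset.sum_nonneg hnn]
    · rw [hE] at h
      push Not at h
      obtain ⟨b, hb⟩ := h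
      have h2 := Finset.single_le_sum hnn (Finset.mem_univ b)
      have h3 : 1 ≤ ((occ y b : ℝ) - ∑ i, U.prob (x i) b) ^ 2 / t ^ 2 := by
        rw [le_div_iff₀ (by positivity), one_mul, ← sq_abs ((occ y b : ℝ) - _)]
        gcongr
      linarith
  rw [h1]
  calc 1 - Fintype.card A * (n / t ^ 2) = 1 - ∑ _b : A, (n / t ^ 2 : ℝ) := by simp
    _ ≤ 1 - ∑ b, (∑ y, (U.memoryless n).prob x y *
        ((occ y b : ℝ) - ∑ i, U.prob (x i) b) ^ 2) / t ^ 2 := by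
        gcongr with b
        exact hvar b
    _ = ∑ y, (U.memoryless n).prob x y *
        (1 - ∑ b, ((occ y b : ℝ) - ∑ i, U.prob (x i) b) ^ 2 / t ^ 2) := by
        simp only [mul_sub, mul_one, Finset.sum_sub_distrib, (U.memoryless n).sum_eq_one,
          Finset.mul_sum, Finset.sum_div]
        rw [Finset.sum_comm]
        simp only [mul_div_assoc]
    _ ≤ _ := Finset.sum_le_sum fun y _ =>
        mul_le_mul_of_nonneg_left (hpt y) ((U.memoryless n).nonneg _ _)

end Channel

namespace Channel

variable {q : ℕ} (U : Channel (Fin q) (Fin q))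

lemma exists_linearIndependent_rows {d : ℕ} (hr : U.matrix.rank = d + 1) :
    ∃ e : Fin (d + 1) → Fin q, LinearIndependent ℝ fun l => U.prob (e l) := by
  rw [Matrix.rank_eq_finrank_span_row] at hr
  obtain ⟨f, hf, -, hli⟩ := Submodule.exists_fun_fin_finrank_span_eq ℝ (Set.range U.matrix.row)
  choose e he using hf
  refine ⟨fun l => e (Fin.cast hr.symm l), ?_⟩
  have : (fun l : Fin (d + 1) => U.prob (e (Fin.cast hr.symm l))) = f ∘ Fin.cast hr.symm := by
    ext1 l
    exact he _
  rw [this]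
  exact hli.comp _ (Fin.cast_injective _)

/-- An injective linear map on a finite-dimensional space is bounded below; in the sup norm the
bound is witnessed at one output letter. -/
lemma exists_le_abs_sum_of_linearIndependent {d : ℕ} {v : Fin d → Fin q → ℝ}
    (hv : LinearIndependent ℝ v) (hq : 0 < q) :
    ∃ κ : ℝ, 0 < κ ∧ ∀ (w : Fin d → ℝ) (l : Fin d), ∃ b, κ * |w l| ≤ |∑ j, w j * v j b| := by
  obtain ⟨K, hK, hKv⟩ := (Fintype.linearCombination ℝ v).exists_antilipschitzWith
    (LinearMap.ker_eq_bot.2 (linearIndependent_iff_injective_fintypeLinearCombination.1 hv))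
  have hK' : (0 : ℝ) < K := hK
  refine ⟨1 / K, by positivity, fun w l => ?_⟩
  by_contra! hlt
  have h0 : 0 < 1 / (K : ℝ) * |w l| := (abs_nonneg _).trans_lt (hlt ⟨0, hq⟩)
  have h1 : ‖Fintype.linearCombination ℝ v w‖ < 1 / K * |w l| := by
    rw [pi_norm_lt_iff h0]
    intro b
    simpa [Fintype.linearCombination_apply, Finset.sum_apply] using hlt b
  have h2 := hKv.le_mul_dist w 0
  rw [map_zero, dist_zero_right, dist_zero_right] at h2
  have h3 : |w l| ≤ ‖w‖ := norm_le_pi_norm w l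
  have h4 : (K : ℝ) * ‖Fintype.linearCombination ℝ v w‖ < K * (1 / K * |w l|) := by gcongr
  have h5 : (K : ℝ) * (1 / K * |w l|) = |w l| := by field_simp
  linarith

/-- A grid of input types with well separated mean output types. -/
lemma exists_separated_inputs {d : ℕ} {e : Fin (d + 1) → Fin q} {κ : ℝ} (hκ : 0 < κ)
    (he : ∀ (w : Fin (d + 1) → ℝ) (l : Fin (d + 1)), ∃ b,
      κ * |w l| ≤ |∑ j, w j * U.prob (e j) b|) {n s T : ℕ} (hT : s * d * T ≤ n) :
    ∃ u : (Fin d → Fin (T + 1)) → Fin n → Fin q, ∀ m m', m ≠ m' →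
      ∃ b, κ * s ≤ |∑ i, U.prob (u m i) b - ∑ i, U.prob (u m' i) b| := by
  -- The symbol `e 0` absorbs the remaining positions, so `d + 1` independent rows give a
  -- `d`-dimensional grid.
  set k : (Fin d → Fin (T + 1)) → Fin (d + 1) → ℕ := fun m =>
    Fin.cons (n - ∑ j, s * (m j : ℕ)) fun j => s * (m j : ℕ) with hk
  have hsum : ∀ m, ∑ l, k m l = n := by
    intro m
    have : ∑ j, s * (m j : ℕ) ≤ n := by
      refine le_trans ?_ hT
      calc ∑ j, s * (m j : ℕ) ≤ ∑ _j : Fin d, s * T :=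
            Finset.sum_le_sum fun j _ => Nat.mul_le_mul_left _ (Nat.lt_succ_iff.1 (m j).2)
        _ = s * d * T := by
            simp only [Finset.sum_const, Finset.card_univ, Fintype.card_fin, smul_eq_mul]
            ring
    rw [Fin.sum_univ_succ]
    simp only [hk, Fin.cons_zero, Fin.cons_succ]
    omega
  choose v hv using fun m => exists_occ_eq (k m) (hsum m)
  refine ⟨fun m i => e (v m i), fun m m' hmm => ?_⟩
  obtain ⟨j, hj⟩ := Function.ne_iff.1 hmm
  obtain ⟨b, hb⟩ := he (fun l => (k m l : ℝ) - k m' l) j.succ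
  refine ⟨b, ?_⟩
  have hocc : ∀ m, ∑ i, U.prob (e (v m i)) b = ∑ l, k m l * U.prob (e l) b := by
    intro m
    rw [sum_comp_eq_sum_occ (v m) fun l => U.prob (e l) b]
    simp only [hv]
  rw [hocc, hocc, ← Finset.sum_sub_distrib]
  simp only [← sub_mul]
  refine le_trans (mul_le_mul_of_nonneg_left ?_ hκ.le) hb
  simp only [hk, Fin.cons_succ]
  push_cast
  rw [← mul_sub, abs_mul, Nat.abs_cast]
  refine le_mul_of_one_le_right (Nat.cast_nonneg s) ?_
  have hne : ((m j : ℕ) : ℤ) - (m' j : ℕ) ≠ 0 := by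
    intro h
    exact hj (Fin.ext (by omega))
  have := Int.one_le_abs hne
  exact_mod_cast this

/-- Finite length achievability. -/
lemma exists_detDecIDCode_noisyPermutation {d : ℕ} (hr : U.matrix.rank = d + 1) (hq : 0 < q) :
    ∃ κ : ℝ, 0 < κ ∧ ∀ n s T M L k : ℕ, 0 < s → s * d * T ≤ n → 1 ≤ k → 1 ≤ M →
      M * 4 ^ k ≤ (T + 1) ^ d → L ≤ 2 ^ M →
      ∃ C : DetDecIDCode (Fin n → Fin q) (Fin n → Fin q) L,
        C.toIDCode.typeI (U.noisyPermutation n) ≤ q * (n / (κ * s) ^ 2) ∧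
        C.toIDCode.typeII (U.noisyPermutation n) ≤ 1 / k + q * (n / (κ * s) ^ 2) := by
  obtain ⟨e, he⟩ := U.exists_linearIndependent_rows hr
  obtain ⟨κ, hκ, hsep⟩ := exists_le_abs_sum_of_linearIndependent he hq
  -- Half the separation is the decoding radius, which makes the decoding sets disjoint.
  refine ⟨κ / 2, by positivity, fun n s T M L k hs hT hk hM hMT hL => ?_⟩
  have hs' : (0 : ℝ) < s := by exact_mod_cast hs
  obtain ⟨u, hu⟩ := U.exists_separated_inputs hκ hsep hT
  obtain ⟨f, hf⟩ := exists_small_agreement M k L hk hL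
  obtain ⟨g⟩ : Nonempty (Fin M × Fin (4 ^ k) ↪ (Fin d → Fin (T + 1))) :=
    Function.Embedding.nonempty_of_card_le (by simpa using hMT)
  classical
  set E : Fin M × Fin (4 ^ k) → Finset (Fin n → Fin q) := fun a =>
    Finset.univ.filter fun y => ∀ b, |(occ y b : ℝ) - ∑ i, U.prob (u (g a) i) b| < κ / 2 * s with hE
  refine exists_detDecIDCode (U.noisyPermutation n) hM (fun a => u (g a)) E ?_ (by positivity) ?_
    hk f hf
  · intro a a' haa
    rw [Finset.disjoint_left]
    intro y hy hy'
    obtain ⟨b, hb⟩ := hu _ _ (g.injective.ne haa)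
    simp only [hE, Finset.mem_filter, Finset.mem_univ, true_and] at hy hy'
    have h1 := abs_lt.1 (hy b)
    have h2 := abs_lt.1 (hy' b)
    have h3 : |∑ i, U.prob (u (g a) i) b - ∑ i, U.prob (u (g a') i) b| < κ * s := by
      rw [abs_lt]
      constructor <;> linarith [h1.1, h1.2, h2.1, h2.2]
    linarith
  · intro a
    have := U.le_sum_noisyPermutation (u (g a)) (t := κ / 2 * s) (by positivity) (E a)
      (fun y => by simp [hE])
    simpa using this

end Channel

lemma exists_detDecIDCode_of_le_one {A B : Type*} [Fintype A] [Fintype B] [DecidableEq A]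
    [DecidableEq B] (P : Channel A B) (a : A) {L : ℕ} (hL : L ≤ 1) :
    ∃ C : DetDecIDCode A B L, C.toIDCode.typeI P ≤ 0 ∧ C.toIDCode.typeII P ≤ 0 := by
  have : Subsingleton (Fin L) := Fin.subsingleton_iff_le_one.2 hL
  set C : DetDecIDCode A B L := ⟨fun _ => uniformOn one_pos fun _ => a, fun _ => Finset.univ⟩ with hC
  refine ⟨C, C.toIDCode.typeI_le P le_rfl fun i => ?_,
    C.toIDCode.typeII_le P le_rfl fun i j hij => absurd (Subsingleton.elim i j) hij⟩
  have h1 := C.toIDCode.missProb_add_acceptProb P i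
  have h2 : C.toIDCode.acceptProb P i i = 1 := by
    rw [DetDecIDCode.acceptProb_toIDCode]
    simp [hC, P.sum_eq_one]
  linarith

/-! ### Asymptotics of achievability -/

/-- Choosing nearly optimal elements turns `∀ δ > 0` into convergence to zero. -/
lemma exists_tendsto_zero {X : ℕ → Type*} (F : ∀ n, X n → ℝ) (hF : ∀ n x, 0 ≤ F n x)
    (hne : ∀ n, Nonempty (X n)) (h : ∀ δ > 0, ∀ᶠ n in atTop, ∃ x : X n, F n x ≤ δ) :
    ∃ x : ∀ n, X n, Tendsto (fun n => F n (x n)) atTop (𝓝 0) := by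
  have hx : ∀ n, ∃ x : X n, F n x < (⨅ x, F n x) + 1 / ((n : ℝ) + 1) := fun n =>
    exists_lt_of_ciInf_lt (lt_add_of_pos_right _ (by positivity))
  choose x hx using hx
  refine ⟨x, ?_⟩
  rw [Metric.tendsto_nhds]
  intro δ hδ
  have h1 := tendsto_one_div_add_atTop_nhds_zero_nat (𝕜 := ℝ)
  filter_upwards [h (δ / 2) (by positivity), h1.eventually_lt_const (half_pos hδ)] with n ⟨z, hz⟩ hn
  rw [Real.dist_0_eq_abs, abs_of_nonneg (hF n _)]
  have h2 : (⨅ x, F n x) ≤ F n z := ciInf_le ⟨0, by rintro _ ⟨w, rfl⟩; exact hF n w⟩ z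
  linarith [hx n]

lemma tendsto_div_logb_atTop : Tendsto (fun n : ℕ => (n : ℝ) / Real.logb 2 n) atTop atTop := by
  have h1 : Tendsto (fun x : ℝ => Real.logb 2 x / x) atTop (𝓝[>] 0) := by
    refine tendsto_nhdsWithin_iff.2 ⟨?_, ?_⟩
    · have := (Real.isLittleO_log_id_atTop.tendsto_div_nhds_zero).div_const (Real.log 2)
      rw [zero_div] at this
      refine this.congr fun x => ?_
      simp only [Real.logb, id]
      ring
    · filter_upwards [eventually_gt_atTop 1] with x hx
      exact div_pos (Real.logb_pos (by norm_num) hx) (by linarith)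
  have h2 := (tendsto_inv_nhdsGT_zero.comp h1).comp (tendsto_natCast_atTop_atTop (R := ℝ))
  refine h2.congr fun n => ?_
  simp

lemma tendsto_logb_atTop : Tendsto (fun n : ℕ => Real.logb 2 n) atTop atTop :=
  (Real.tendsto_logb_atTop (by norm_num)).comp tendsto_natCast_atTop_atTop

/-- The size of the grid of input types. -/
lemma le_grid_card {n d : ℕ} (hd : 0 < d) (hn : 2 ≤ n) :
    ((n : ℝ) / Real.logb 2 n) ^ ((d : ℝ) / 2) / (2 * d) ^ d ≤
      (((n / (⌈√(n * Real.logb 2 n)⌉₊ * d) + 1) ^ d : ℕ) : ℝ) := by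
  have hn' : (2 : ℝ) ≤ n := by exact_mod_cast hn
  have hd' : (0 : ℝ) < d := by exact_mod_cast hd
  have hlog : 1 ≤ Real.logb 2 n := by
    rw [Real.le_logb_iff_rpow_le (by norm_num) (by linarith)]
    simpa using hn'
  set l := Real.logb 2 n with hl
  have h1 : 1 ≤ √(n * l) := Real.one_le_sqrt.2 (by nlinarith)
  have hs : (⌈√(n * l)⌉₊ : ℝ) ≤ 2 * √(n * l) := by
    linarith [Nat.ceil_lt_add_one (Real.sqrt_nonneg (n * l))]
  have hs0 : 0 < ⌈√(n * l)⌉₊ := Nat.ceil_pos.2 (by linarith)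
  have hs0' : (0 : ℝ) < ⌈√(n * l)⌉₊ := by exact_mod_cast hs0
  have hx : 0 ≤ (n : ℝ) / l := by positivity
  have h2 : ((n : ℝ) / l) ^ ((d : ℝ) / 2) = √(n / l) ^ d := by
    rw [Real.sqrt_eq_rpow, ← Real.rpow_natCast, ← Real.rpow_mul hx]
    congr 1
    ring
  rw [h2, ← div_pow]
  push_cast
  gcongr
  have h3 : (n : ℝ) / (⌈√(n * l)⌉₊ * d : ℕ) < (n / (⌈√(n * l)⌉₊ * d) : ℕ) + 1 := by
    rw [← Nat.floor_div_eq_div (K := ℝ)]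
    exact Nat.lt_floor_add_one _
  refine le_trans ?_ h3.le
  have h4 : √((n : ℝ) / l) = n / √(n * l) := by
    rw [Real.sqrt_div (by positivity), Real.sqrt_mul (by positivity)]
    have : 0 < √(n : ℝ) := Real.sqrt_pos.2 (by linarith)
    have : 0 < √l := Real.sqrt_pos.2 (by linarith)
    field_simp
    exact Real.sq_sqrt (by positivity)
  rw [h4, div_div]
  push_cast
  exact div_le_div_of_nonneg_left (by positivity) (by positivity) (by nlinarith)

/-- With spacing `s ≈ √(n log n)` the decoding error is of order `n / s ^ 2 ≤ 1 / log n`. As `k`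
depends on `δ` only, the word length `M` is a fixed fraction of the grid size, which eventually
beats the exponent because `ε n → 0`. -/
lemma eventually_exists_code {q d : ℕ} (hq : 0 < q) (U : Channel (Fin q) (Fin q))
    (hr : U.matrix.rank = d + 1) (hd : 0 < d) {ε : ℕ → ℝ} (hε : Tendsto ε atTop (𝓝 0)) {δ : ℝ}
    (hδ : 0 < δ) :
    ∀ᶠ n : ℕ in atTop, ∃ C : DetDecIDCode (Fin n → Fin q) (Fin n → Fin q)
        ⌊(2 : ℝ) ^ (ε n * ((n : ℝ) / Real.logb 2 n) ^ ((d : ℝ) / 2))⌋₊,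
      C.toIDCode.typeI (U.noisyPermutation n) ≤ δ ∧
        C.toIDCode.typeII (U.noisyPermutation n) ≤ δ := by
  obtain ⟨κ, hκ, hcode⟩ := U.exists_detDecIDCode_noisyPermutation hr hq
  obtain ⟨k, hk⟩ := exists_nat_gt (2 / δ)
  have hk0 : (0 : ℝ) < k := (by positivity : 0 < 2 / δ).trans hk
  have hk1 : 1 ≤ k := by exact_mod_cast hk0
  have hkδ : 1 / (k : ℝ) ≤ δ / 2 := by
    rw [div_lt_iff₀ hδ] at hk
    rw [div_le_div_iff₀ hk0 (by norm_num)]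
    linarith
  have hd' : (0 : ℝ) < d := by exact_mod_cast hd
  -- The loss in `le_grid_card` times the alphabet size. Below, `2 ≤ a * Z` absorbs the floor in
  -- `M`, leaving `M ≥ a * Z / 2 ≥ ε n * Z`.
  set a : ℝ := 1 / ((2 * d) ^ d * 4 ^ k) with ha
  have hapos : 0 < a := by positivity
  have hZ : Tendsto (fun n : ℕ => ((n : ℝ) / Real.logb 2 n) ^ ((d : ℝ) / 2)) atTop atTop :=
    (tendsto_rpow_atTop (by positivity)).comp tendsto_div_logb_atTop
  filter_upwards [eventually_ge_atTop 2, hZ.eventually_ge_atTop (2 / a),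
    hε.eventually_le_const (half_pos hapos),
    tendsto_logb_atTop.eventually_ge_atTop (2 * q / (δ * κ ^ 2)),
    tendsto_logb_atTop.eventually_ge_atTop 1] with n hn hnZ hnε hnl hl1
  have hn' : (2 : ℝ) ≤ n := by exact_mod_cast hn
  have hgrid := le_grid_card hd hn
  set l := Real.logb 2 n with hl
  set Z := ((n : ℝ) / l) ^ ((d : ℝ) / 2) with hZdef
  set s := ⌈√(n * l)⌉₊ with hs
  have hnl0 : 0 < (n : ℝ) * l := by positivity
  have hs0 : 0 < s := Nat.ceil_pos.2 (Real.sqrt_pos.2 hnl0)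
  set T := n / (s * d) with hT
  set M := (T + 1) ^ d / 4 ^ k with hM
  have hMZ : a * Z - 1 < M := by
    have h1 : (((T + 1) ^ d : ℕ) : ℝ) / (4 ^ k : ℕ) < M + 1 := by
      rw [hM, ← Nat.floor_div_eq_div (K := ℝ)]
      exact Nat.lt_floor_add_one _
    have h2 : a * Z ≤ (((T + 1) ^ d : ℕ) : ℝ) / (4 ^ k : ℕ) := by
      calc a * Z = Z / (2 * d) ^ d / (4 ^ k : ℕ) := by
            rw [ha]
            push_cast
            field_simp
        _ ≤ _ := by gcongr
    linarith
  have haZ : 2 ≤ a * Z := by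
    rw [div_le_iff₀ hapos] at hnZ
    linarith
  have hM1 : 1 ≤ M := by
    have : (0 : ℝ) < M := by linarith
    exact_mod_cast this
  have hL : ⌊(2 : ℝ) ^ (ε n * Z)⌋₊ ≤ 2 ^ M := by
    refine Nat.floor_le_of_le ?_
    push_cast
    rw [← Real.rpow_natCast]
    refine Real.rpow_le_rpow_of_exponent_le (by norm_num) ?_
    have hZ0 : 0 ≤ Z := by positivity
    nlinarith [mul_le_mul_of_nonneg_right hnε hZ0]
  obtain ⟨C, hC1, hC2⟩ := hcode n s T M _ k hs0 (Nat.mul_div_le n (s * d)) hk1 hM1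
    (Nat.div_mul_le_self _ _) hL
  have herr : (q : ℝ) * (n / (κ * s) ^ 2) ≤ δ / 2 := by
    have h1 : (n : ℝ) * l ≤ (s : ℝ) ^ 2 := by
      rw [← Real.sqrt_le_left (Nat.cast_nonneg s)]
      exact Nat.le_ceil _
    have h2 : (q : ℝ) * 2 ≤ δ * κ ^ 2 * l := by
      rw [div_le_iff₀ (by positivity)] at hnl
      linarith
    rw [mul_div_assoc', div_le_div_iff₀ (by positivity) (by norm_num), mul_pow]
    calc (q : ℝ) * n * 2 = n * (q * 2) := by ring
      _ ≤ n * (δ * κ ^ 2 * l) := by gcongr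
      _ = δ * κ ^ 2 * (n * l) := by ring
      _ ≤ δ * κ ^ 2 * (s : ℝ) ^ 2 := by gcongr
      _ = _ := by ring
  exact ⟨C, hC1.trans (by linarith), hC2.trans (by linarith)⟩

theorem achievability (q : ℕ) (hq : 0 < q) (U : Channel (Fin q) (Fin q)) (ε : ℕ → ℝ)
    (hε : Tendsto ε atTop (𝓝 0)) :
    ∃ C : (n : ℕ) → DetDecIDCode (Fin n → Fin q) (Fin n → Fin q)
          ⌊(2 : ℝ) ^ (ε n * ((n : ℝ) / Real.logb 2 n) ^ (((U.matrix.rank : ℝ) - 1) / 2))⌋₊,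
        Tendsto (fun n => (C n).toIDCode.typeI (U.noisyPermutation n)) atTop (𝓝 0) ∧
        Tendsto (fun n => (C n).toIDCode.typeII (U.noisyPermutation n)) atTop (𝓝 0) := by
  -- Rows sum to one, so the matrix is nonzero.
  have hrank : U.matrix.rank ≠ 0 := by
    intro h0
    rw [Matrix.rank_eq_finrank_span_row, Submodule.finrank_eq_zero, Submodule.span_eq_bot] at h0
    have h1 := U.sum_eq_one ⟨0, hq⟩
    have h2 : ∀ b, U.prob ⟨0, hq⟩ b = 0 := congrFun (h0 _ ⟨⟨0, hq⟩, rfl⟩)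
    simp [h2] at h1
  obtain ⟨d, hr⟩ := Nat.exists_eq_succ_of_ne_zero hrank
  have hexp : ((U.matrix.rank : ℝ) - 1) / 2 = (d : ℝ) / 2 := by
    rw [hr]
    push_cast
    ring
  rw [hexp]
  obtain ⟨C, hC⟩ := exists_tendsto_zero
    (X := fun n => DetDecIDCode (Fin n → Fin q) (Fin n → Fin q)
      ⌊(2 : ℝ) ^ (ε n * ((n : ℝ) / Real.logb 2 n) ^ ((d : ℝ) / 2))⌋₊)
    (fun n C => C.toIDCode.typeI (U.noisyPermutation n) +
      C.toIDCode.typeII (U.noisyPermutation n))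
    (fun n C => add_nonneg (C.toIDCode.typeI_nonneg _) (C.toIDCode.typeII_nonneg _))
    (fun n => ⟨⟨fun _ => uniformOn one_pos fun _ _ => ⟨0, hq⟩, fun _ => ∅⟩⟩) (fun δ hδ => by
      -- In rank one the message size is `⌊2 ^ ε n⌋`, eventually at most 1, and the code that always
      -- accepts has no errors.
      rcases Nat.eq_zero_or_pos d with rfl | hd
      · filter_upwards [hε.eventually_lt_const one_pos] with n hn
        have hL : ⌊(2 : ℝ) ^ (ε n * ((n : ℝ) / Real.logb 2 n) ^ (((0 : ℕ) : ℝ) / 2))⌋₊ ≤ 1 := by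
          refine Nat.lt_succ_iff.1 ((Nat.floor_lt' (by norm_num)).2 ?_)
          simpa using Real.rpow_lt_rpow_of_exponent_lt (by norm_num : (1 : ℝ) < 2) hn
        obtain ⟨C, h1, h2⟩ := exists_detDecIDCode_of_le_one (U.noisyPermutation n)
          (fun _ => ⟨0, hq⟩) hL
        exact ⟨C, by linarith⟩
      · filter_upwards [eventually_exists_code hq U hr hd hε (half_pos hδ)] with n ⟨C, h1, h2⟩
        exact ⟨C, by linarith⟩)
  refine ⟨C, squeeze_zero (fun n => (C n).toIDCode.typeI_nonneg _) (fun n => ?_) hC,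
    squeeze_zero (fun n => (C n).toIDCode.typeII_nonneg _) (fun n => ?_) hC⟩
  · exact le_add_of_nonneg_right ((C n).toIDCode.typeII_nonneg _)
  · exact le_add_of_nonneg_left ((C n).toIDCode.typeI_nonneg _)

end IdCoding

theorem theorem1 (q : ℕ) (hq : 2 ≤ q) (U : IdCoding.Channel (Fin q) (Fin q)) :
    -- achievability
    (∀ ε : ℕ → ℝ, Tendsto ε atTop (𝓝 0) →
      ∃ C : (n : ℕ) → IdCoding.DetDecIDCode (Fin n → Fin q) (Fin n → Fin q)
          ⌊(2 : ℝ) ^ (ε n * ((n : ℝ) / Real.logb 2 n) ^ (((U.matrix.rank : ℝ) - 1) / 2))⌋₊,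
        Tendsto (fun n => (C n).toIDCode.typeI (U.noisyPermutation n)) atTop (𝓝 0) ∧
        Tendsto (fun n => (C n).toIDCode.typeII (U.noisyPermutation n)) atTop (𝓝 0)) ∧
    -- strong converse
    ((∀ a b, 0 < U.prob a b) →
      ∀ (n : ℕ → ℕ) (c : ℕ → ℝ), Tendsto n atTop atTop → Tendsto c atTop atTop →
      ∀ L : ℕ → ℕ,
        (∀ i, ⌊(2 : ℝ) ^ (c i * (n i : ℝ) ^ (((q : ℝ) - 1) / 2) *
          (Real.logb 2 (n i)) ^ (1 + ((q : ℝ) - 1) * ((q : ℝ) - 2) / 2))⌋₊ ≤ L i) →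
      ∀ C : (i : ℕ) → IdCoding.IDCode (Fin (n i) → Fin q) (Fin (n i) → Fin q) (L i),
        1 ≤ liminf (fun i => (C i).typeI (U.noisyPermutation (n i)) +
          (C i).typeII (U.noisyPermutation (n i))) atTop) := by
  exact ⟨fun ε hε => IdCoding.achievability q (by omega) U ε hε,
    fun hU n c hn hc L hL C => IdCoding.strong_converse q hq U hU n c hn hc L hL C⟩
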